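/- Let $(\overline M,\overline g)$ be a smooth semi-Riemannian manifold with Levi-Civita connection $\overline\nabla$, and let $x:M\to\overline M$ be an embedded null hypersurface, i.e. $\dim\overline M=\dim M+1$ and the induced tensor $g=x^\star\overline g$ is degenerate at every point of $M$. Let $N$ be a null rigging for $M$: a smooth vector field on an open subset of $\overline M$ containing $M$ such that, at each $p\in M$, $N_p\notin T_pM$ and $\overline g(N_p,N_p)=0$. Let $\eta=x^\star(\overline g(N,\cdot))$, and let $\xi$ be the rigged vector field, i.e. the unique section of $TM^\perp=\{X\in TM:\ g(X,\cdot)=0\}$ with $\overline g(\xi,N)=1$. For $X,Y$ tangent to $M$, write $\overline\nabla_XY=\nabla_XY+B(X,Y)N$ with $\nabla_XY$ tangent to $M$; this defines the induced connection $\nabla$ and the second fundamental form $B$. Let $\alpha$ be a nowhere vanishing smooth function on $M$ and $g_\alpha=g+\alpha\,\eta\otimes\eta$. Write $\omega^{\#g_\alpha}$ for the vector field that is $g_\alpha$-metrically equivalent to a $1$-form $\omega$, $i_Xd\eta=d\eta(X,\cdot)$ with $d\eta(X,Y)=X\cdot\eta(Y)-Y\cdot\eta(X)-\eta([X,Y])$,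 and $L_N\overline g$ for the Lie derivative of $\overline g$ along $N$. Then $g_\alpha$ is a semi-Riemannian metric on $M$, and its Levi-Civita connection $\nabla_{\!\alpha}$ satisfies, for all vector fields $X,Y$ on $M$, \begin{align*} {\nabla_{\!\alpha}}_XY&=\nabla_XY-\frac12\eta(X)\eta(Y)\,d\alpha^{\#g_\alpha}+\frac{\alpha}{2}\left[\eta(X)(i_Yd\eta)^{\#g_\alpha}+\eta(Y)(i_Xd\eta)^{\#g_\alpha}\right]\\ &\quad+\frac1{2\alpha}\left[\alpha(L_N\overline g)(X,Y)+2B(X,Y)+d\alpha(X)\eta(Y)+d\alpha(Y)\eta(X)\right]\xi . \end{align*} If moreover the rigging is closed, i.e. $d\eta=0$ on $M$, then \begin{align*} {\nabla_{\!\alpha}}_XY&=\nabla_XY-\frac12\eta(X)\eta(Y)\,d\alpha^{\#g_\alpha}\\ &\quad+\frac1{2\alpha}\left[2B(X,Y)-2\alpha C(X,PY)+2\alpha\tau(X)\eta(Y)+d\alpha(X)\eta(Y)+d\alpha(Y)\eta(X)\right]\xi , \end{align*} where $P$ is the projection of $TM$ onto the screen distribution $\ker\eta$ along $\xi$, $C(X,PY)$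 is the coefficient of $\xi$ in the decomposition of $\nabla_XPY$ along $TM=\ker\eta\oplus\mathrm{span}(\xi)$, and $\tau(X)=\overline g(\overline\nabla_XN,\xi)$. -/

import Mathlib

open scoped Manifold ContDiff Bundle
open Bundle

namespace NullRigging

noncomputable section

section Intrinsic

variable {E : Type*} [NormedAddCommGroup E] [NormedSpace ℝ E]
  {M : Type*} [TopologicalSpace M] [ChartedSpace E M]

/-- A field of bilinear forms (a covariant `2`-tensor field, no regularity required) on `M`. -/
abbrev BilinField (E : Type*) [NormedAddCommGroup E] [NormedSpace ℝ E]
    (M : Type*) [TopologicalSpace M] [ChartedSpace E M] :=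
  ∀ p : M, TangentSpace 𝓘(ℝ, E) p →L[ℝ] TangentSpace 𝓘(ℝ, E) p →L[ℝ] ℝ

/-- A field of linear forms (a `1`-form, no regularity required) on `M`. -/
abbrev FormField (E : Type*) [NormedAddCommGroup E] [NormedSpace ℝ E]
    (M : Type*) [TopologicalSpace M] [ChartedSpace E M] :=
  ∀ p : M, TangentSpace 𝓘(ℝ, E) p →L[ℝ] ℝ

/-- A (not necessarily continuous) vector field on `M`. -/
abbrev VField (E : Type*) [NormedAddCommGroup E] [NormedSpace ℝ E]
    (M : Type*) [TopologicalSpace M] [ChartedSpace E M] :=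
  ∀ p : M, TangentSpace 𝓘(ℝ, E) p

/-- The vector field `X` is differentiable at `p`. -/
def DiffAt [IsManifold 𝓘(ℝ, E) ∞ M] (X : VField E M) (p : M) : Prop :=
  MDifferentiableAt 𝓘(ℝ, E) (𝓘(ℝ, E).prod 𝓘(ℝ, E))
    (fun q ↦ (TotalSpace.mk' E q (X q) : TangentBundle 𝓘(ℝ, E) M)) p

/-- `g` is a semi-Riemannian metric: a smooth field of nondegenerate symmetric bilinear forms. -/
structure IsSemiRiemannian [IsManifold 𝓘(ℝ, E) ∞ M] (g : BilinField E M) : Prop where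
  smooth : ContMDiff 𝓘(ℝ, E) (𝓘(ℝ, E).prod 𝓘(ℝ, E →L[ℝ] E →L[ℝ] ℝ)) ∞
    (fun p ↦ TotalSpace.mk' (E →L[ℝ] E →L[ℝ] ℝ)
      (E := fun p : M ↦ TangentSpace 𝓘(ℝ, E) p →L[ℝ] TangentSpace 𝓘(ℝ, E) p →L[ℝ] ℝ) p (g p))
  symm : ∀ p u v, g p u v = g p v u
  nondeg : ∀ p u, (∀ v, g p u v = 0) → u = 0

/-- The covariant derivative `D` on `TM` (written `D Y p v = (∇_v Y)(p)`) is a Levi-Civita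
connection of `g`: it is torsion-free, and
`v (g(Y, Z)) = g(∇_v Y, Z) + g(Y, ∇_v Z)`. -/
structure IsLeviCivita [FiniteDimensional ℝ E] [IsManifold 𝓘(ℝ, E) ∞ M] (g : BilinField E M)
    (D : CovariantDerivative 𝓘(ℝ, E) E (TangentSpace 𝓘(ℝ, E) : M → Type _)) : Prop where
  torsion_free : ∀ (p : M) (X Y : VField E M), DiffAt X p → DiffAt Y p →
    D Y p (X p) - D X p (Y p) = VectorField.mlieBracket 𝓘(ℝ, E) X Y p
  metric : ∀ (p : M) (Y Z : VField E M) (v : TangentSpace 𝓘(ℝ, E) p), DiffAt Y p → DiffAt Z p →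
    mvfderiv 𝓘(ℝ, E) (fun q ↦ g q (Y q) (Z q)) p v = g p (D Y p v) (Z p) + g p (Y p) (D Z p v)

/-- The local extension of a tangent vector `v` at `p` to a vector field which is constant in
the chart at `p`. -/
def ext [IsManifold 𝓘(ℝ, E) ∞ M] {p : M} (v : TangentSpace 𝓘(ℝ, E) p) : VField E M :=
  FiberBundle.extend E v

/-- The exterior derivative of a `1`-form at `p`,
`dη(U, V) = U(η(V)) - V(η(U)) - η([U, V])`,
evaluated on tangent vectors `u`, `v` by means of local extensions `U`, `V`. -/
def extDeriv₁ [IsManifold 𝓘(ℝ, E) ∞ M] (η : FormField E M) (p : M)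
    (u v : TangentSpace 𝓘(ℝ, E) p) : ℝ :=
  mvfderiv 𝓘(ℝ, E) (fun q ↦ η q (ext v q)) p u
    - mvfderiv 𝓘(ℝ, E) (fun q ↦ η q (ext u q)) p v
    - η p (VectorField.mlieBracket 𝓘(ℝ, E) (ext u) (ext v) p)

/-- The Lie derivative of `g` along the vector field `N` at `p`,
`(L_N g)(U, V) = N(g(U, V)) - g([N, U], V) - g(U, [N, V])`,
evaluated on tangent vectors `u`, `v` by means of local extensions `U`, `V`. -/
def lieDeriv [IsManifold 𝓘(ℝ, E) ∞ M] (N : VField E M) (g : BilinField E M) (p : M)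
    (u v : TangentSpace 𝓘(ℝ, E) p) : ℝ :=
  mvfderiv 𝓘(ℝ, E) (fun q ↦ g q (ext u q) (ext v q)) p (N p)
    - g p (VectorField.mlieBracket 𝓘(ℝ, E) N (ext u) p) v
    - g p u (VectorField.mlieBracket 𝓘(ℝ, E) N (ext v) p)

/-- The vector `θ^#` at `p` which is `g`-metrically equivalent to the linear form `θ`, i.e. the
vector with `g(θ^#, w) = θ(w)` for all `w` (unique if `g` is nondegenerate). -/
def sharp (g : BilinField E M) (p : M) (θ : TangentSpace 𝓘(ℝ, E) p → ℝ) :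
    TangentSpace 𝓘(ℝ, E) p :=
  Classical.epsilon fun v ↦ ∀ w, g p v w = θ w

/-- `g + α η ⊗ η`. -/
def assocMetric (g : BilinField E M) (α : M → ℝ) (η : FormField E M) : BilinField E M :=
  fun p ↦ g p + α p • (η p).smulRight (η p)

end Intrinsic

section Hypersurface

variable {E : Type*} [NormedAddCommGroup E] [NormedSpace ℝ E]
  {M : Type*} [TopologicalSpace M] [ChartedSpace E M]
  {F : Type*} [NormedAddCommGroup F] [NormedSpace ℝ F]
  {W : Type*} [TopologicalSpace W] [ChartedSpace F W]

/-- The differential of `x : M → W` at `p`, identifying `T_p M` with a subspace of `T_{x p} W`. -/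
def incl (E F : Type*) [NormedAddCommGroup E] [NormedSpace ℝ E]
    [NormedAddCommGroup F] [NormedSpace ℝ F]
    {M : Type*} [TopologicalSpace M] [ChartedSpace E M]
    {W : Type*} [TopologicalSpace W] [ChartedSpace F W] (x : M → W) (p : M) :
    TangentSpace 𝓘(ℝ, E) p →L[ℝ] TangentSpace 𝓘(ℝ, F) (x p) :=
  mfderiv 𝓘(ℝ, E) 𝓘(ℝ, F) x p

/-- The pull-back `g = x^* G` of a bilinear form field. -/
def pullMetric (x : M → W) (G : BilinField F W) : BilinField E M :=
  fun p ↦ ((incl E F x p).precomp ℝ).comp ((G (x p)).comp (incl E F x p))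

/-- The pull-back `η` to `M` of the `1`-form `G(N, ·)`. -/
def rigForm (x : M → W) (G : BilinField F W) (N : VField F W) : FormField E M :=
  fun p ↦ (G (x p) (N (x p))).comp (incl E F x p)

/-- `x : M → W` is an embedded submanifold: a smooth immersion which is a homeomorphism
onto its image. -/
structure IsSubmanifold (E F : Type*) [NormedAddCommGroup E] [NormedSpace ℝ E]
    [NormedAddCommGroup F] [NormedSpace ℝ F]
    {M : Type*} [TopologicalSpace M] [ChartedSpace E M]
    {W : Type*} [TopologicalSpace W] [ChartedSpace F W] (x : M → W) : Prop where
  smooth : ContMDiff 𝓘(ℝ, E) 𝓘(ℝ, F) ∞ x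
  immersion : ∀ p, Function.Injective (incl E F x p)
  embedding : Topology.IsEmbedding x

/-- The bilinear form field `g` is degenerate at every point. -/
def IsNull (g : BilinField E M) : Prop :=
  ∀ p, ∃ u, u ≠ 0 ∧ ∀ v, g p u v = 0

/-- `N`, a smooth vector field on the open set `O ⊇ x(M)`, is a null rigging for `x : M → W`:
at the points of `M` it is transversal to `M` and lightlike. -/
structure IsNullRigging (E F : Type*) [NormedAddCommGroup E] [NormedSpace ℝ E]
    [NormedAddCommGroup F] [NormedSpace ℝ F]
    {M : Type*} [TopologicalSpace M] [ChartedSpace E M]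
    {W : Type*} [TopologicalSpace W] [ChartedSpace F W] [IsManifold 𝓘(ℝ, F) ∞ W]
    (x : M → W) (G : BilinField F W) (O : Set W) (N : VField F W) : Prop where
  isOpen : IsOpen O
  mem : ∀ p, x p ∈ O
  smooth : ContMDiffOn 𝓘(ℝ, F) (𝓘(ℝ, F).prod 𝓘(ℝ, F)) ∞
    (fun q ↦ (TotalSpace.mk' F q (N q) : TangentBundle 𝓘(ℝ, F) W)) O
  transversal : ∀ p, N (x p) ∉ Set.range (incl E F x p)
  lightlike : ∀ p, G (x p) (N (x p)) (N (x p)) = 0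

/-- The rigged vector field `ξ`: the section of the radical `TM^⊥` with `G(ξ, N) = 1`. -/
def rigged (x : M → W) (G : BilinField F W) (N : VField F W) : VField E M :=
  fun p ↦ Classical.epsilon fun v : TangentSpace 𝓘(ℝ, E) p ↦
    (∀ w, pullMetric (E := E) x G p v w = 0) ∧ rigForm (E := E) x G N p v = 1

/-- The components `(u, b)` of `w = dx(u) + b N` in `T_{x p} W = T_p M ⊕ span(N)`. -/
def split (x : M → W) (N : VField F W) (p : M) (w : TangentSpace 𝓘(ℝ, F) (x p)) :
    TangentSpace 𝓘(ℝ, E) p × ℝ :=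
  Classical.epsilon fun c : TangentSpace 𝓘(ℝ, E) p × ℝ ↦ w = incl E F x p c.1 + c.2 • N (x p)

/-- The derivative `∇̄_v Z` at `p`, `v ∈ T_p M`, of a section `Z` of `TW` along `x : M → W`
for the pull-back to `x^* TW` of the connection `D` of `W`. If `s₁, s₂, …` is the local frame of
`TW` given by the trivialization at `x p`, and `Z = ∑ zⁱ (sᵢ ∘ x)`, this is
`∑ v(zⁱ) sᵢ + ∑ zⁱ(p) D_{dx(v)} sᵢ`; the first sum is the first summand below (the derivative of
`Z` read in the trivialization), and the second sum is the second one, because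
`ext (Z p) = ∑ zⁱ(p) sᵢ`. -/
def derivAlong [FiniteDimensional ℝ F] [IsManifold 𝓘(ℝ, F) ∞ W]
    (D : CovariantDerivative 𝓘(ℝ, F) F (TangentSpace 𝓘(ℝ, F) : W → Type _)) (x : M → W)
    (Z : ∀ p : M, TangentSpace 𝓘(ℝ, F) (x p)) (p : M) (v : TangentSpace 𝓘(ℝ, E) p) :
    TangentSpace 𝓘(ℝ, F) (x p) :=
  (trivializationAt F (TangentSpace 𝓘(ℝ, F) : W → Type _) (x p)).symm (x p)
      (mvfderiv 𝓘(ℝ, E)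
        (fun q ↦ (trivializationAt F (TangentSpace 𝓘(ℝ, F) : W → Type _) (x p)
          (TotalSpace.mk' F (x q) (Z q))).2) p v)
    + D (ext (Z p)) (x p) (incl E F x p v)

variable [FiniteDimensional ℝ F] [IsManifold 𝓘(ℝ, F) ∞ W]

/-- The ambient derivative `∇̄_X Y` at `p` of vector fields of `M`. -/
def ambientNabla (D : CovariantDerivative 𝓘(ℝ, F) F (TangentSpace 𝓘(ℝ, F) : W → Type _))
    (x : M → W) (X Y : VField E M) (p : M) : TangentSpace 𝓘(ℝ, F) (x p) :=
  derivAlong D x (fun q ↦ incl E F x q (Y q)) p (X p)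

/-- The induced connection: `∇_X Y` is the component of `∇̄_X Y` in `TM` along `N`. -/
def nabla (D : CovariantDerivative 𝓘(ℝ, F) F (TangentSpace 𝓘(ℝ, F) : W → Type _))
    (x : M → W) (N : VField F W) (X Y : VField E M) : VField E M :=
  fun p ↦ (split x N p (ambientNabla D x X Y p)).1

/-- The second fundamental form: `∇̄_X Y = ∇_X Y + B(X, Y) N`. -/
def sff (D : CovariantDerivative 𝓘(ℝ, F) F (TangentSpace 𝓘(ℝ, F) : W → Type _))
    (x : M → W) (N : VField F W) (X Y : VField E M) (p : M) : ℝ :=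
  (split (E := E) x N p (ambientNabla D x X Y p)).2

/-- The projection `P Y = Y - η(Y) ξ` of `TM` onto the screen distribution `ker η` along `ξ`. -/
def screenProj (x : M → W) (G : BilinField F W) (N : VField F W) (Y : VField E M) : VField E M :=
  fun p ↦ Y p - rigForm x G N p (Y p) • rigged x G N p

/-- The second fundamental form `C` of the screen distribution: `C(X, PY)` is the coefficient
of `ξ` in the decomposition of `∇_X PY` along `TM = ker η ⊕ span ξ`; as `η(ξ) = 1`, this
coefficient is `η(∇_X PY)`. -/
def screenSff (D : CovariantDerivative 𝓘(ℝ, F) F (TangentSpace 𝓘(ℝ, F) : W → Type _))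
    (x : M → W) (G : BilinField F W) (N : VField F W) (X Y : VField E M) (p : M) : ℝ :=
  rigForm x G N p (nabla D x N X (screenProj x G N Y) p)

/-- The rotation `1`-form `τ(X) = G(∇̄_X N, ξ)`. -/
def rotation (D : CovariantDerivative 𝓘(ℝ, F) F (TangentSpace 𝓘(ℝ, F) : W → Type _))
    (x : M → W) (G : BilinField F W) (N : VField F W) (X : VField E M) (p : M) : ℝ :=
  G (x p) (D N (x p) (incl E F x p (X p))) (incl E F x p (rigged x G N p))

end Hypersurface

end

end NullRigging

namespace NullRigging

/-! ### Derivatives, Lie brackets and the differential of a map, read in the preferred charts -/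

section Coordinates

variable {E : Type*} [NormedAddCommGroup E] [NormedSpace ℝ E]
  {M : Type*} [TopologicalSpace M] [ChartedSpace E M]
  {F : Type*} [NormedAddCommGroup F] [NormedSpace ℝ F]
  {W : Type*} [TopologicalSpace W] [ChartedSpace F W]
  {V : Type*} [NormedAddCommGroup V] [NormedSpace ℝ V]
  {V' : Type*} [NormedAddCommGroup V'] [NormedSpace ℝ V']

/-! Nondegeneracy of `gα`: pairing `u` with `ξ` gives `α η(u)`, so a `gα`-null `u` has `η(u) = 0`,
hence also `g(u, ·) = 0`. Then `dx(u)` is `G`-orthogonal to `TM` and to `N`, which together span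
`TW`, and so `u = 0`.

The connection formula is the Koszul formula, tested against an arbitrary `w` with `gα`. The
derivative `∇̄` along `x` is metric (`IsLeviCivita.mvfderiv_along`), agrees with `D` on restrictions
of ambient fields such as `N` (`IsLeviCivita.derivAlong_comp`), and is symmetric
(`IsLeviCivita.derivAlong_symm`). Hence every derivative of `g` and `η`, and every bracket on `M`,
becomes an expression in `G(∇̄_u V, ·)` and `G(∇̄_u N, ·)`. The antisymmetric part of `(u, v) ↦
G(∇̄_u N, v)` gives `dη` (`extDeriv₁_rigForm`), the symmetric part gives `L_N G`
(`lieDeriv_rigging`). Since `gα(ξ, w) = α η(w)`, every term proportional to `η(w)` becomes a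
multiple of `ξ` divided by `α`, and the other terms are recovered by sharps. What remains is linear
algebra over the scalars (`leviCivita_assocMetric_eq`).

If `dη = 0`, then `G(∇̄_u N, v)` is symmetric, so `L_N G(X, Y) = 2 G(∇̄_X N, Y)`. Splitting `Y = PY
+ η(Y) ξ` and differentiating `η(PY) = 0` turns this into `-2 C(X, PY) + 2 τ(X) η(Y)`
(`apply_rigging_eq_neg_screenSff`). -/

theorem differentiableAt_comp_extChartAt_symm {f : M → V} {p : M}
    (h : MDifferentiableAt 𝓘(ℝ, E) 𝓘(ℝ, V) f p) :
    DifferentiableAt ℝ (f ∘ (extChartAt 𝓘(ℝ, E) p).symm) (extChartAt 𝓘(ℝ, E) p p) := by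
  have := h.differentiableWithinAt_writtenInExtChartAt
  simpa [writtenInExtChartAt, Function.comp_def, differentiableWithinAt_univ] using! this

theorem mvfderiv_eq_fderiv {f : M → V} {p : M}
    (h : MDifferentiableAt 𝓘(ℝ, E) 𝓘(ℝ, V) f p) (v : TangentSpace 𝓘(ℝ, E) p) :
    mvfderiv 𝓘(ℝ, E) f p v =
      fderiv ℝ (f ∘ (extChartAt 𝓘(ℝ, E) p).symm) (extChartAt 𝓘(ℝ, E) p p) v := by
  rw [h.mvfderiv]
  simp only [modelWithCornersSelf_coe, Set.range_id, fderivWithin_univ]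
  rfl

theorem mvfderiv_congr {f g : M → V} {p : M} (h : f =ᶠ[nhds p] g)
    (v : TangentSpace 𝓘(ℝ, E) p) :
    mvfderiv 𝓘(ℝ, E) f p v = mvfderiv 𝓘(ℝ, E) g p v := by
  have h' := h.mfderiv_eq (I := 𝓘(ℝ, E)) (I' := 𝓘(ℝ, V))
  have h'' : mfderiv 𝓘(ℝ, E) 𝓘(ℝ, V) f p v = mfderiv 𝓘(ℝ, E) 𝓘(ℝ, V) g p v :=
    congrArg (fun L : E →L[ℝ] V ↦ L v) h'
  exact h''

theorem mvfderiv_clm_apply {A : M → V →L[ℝ] V'} {b : M → V} {p : M}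
    (hA : MDifferentiableAt 𝓘(ℝ, E) 𝓘(ℝ, V →L[ℝ] V') A p)
    (hb : MDifferentiableAt 𝓘(ℝ, E) 𝓘(ℝ, V) b p) (v : TangentSpace 𝓘(ℝ, E) p) :
    mvfderiv 𝓘(ℝ, E) (fun q ↦ A q (b q)) p v =
      mvfderiv 𝓘(ℝ, E) A p v (b p) + A p (mvfderiv 𝓘(ℝ, E) b p v) := by
  rw [mvfderiv_eq_fderiv (hA.clm_apply hb), mvfderiv_eq_fderiv hA, mvfderiv_eq_fderiv hb]
  have key : ∀ w : E,
      fderiv ℝ ((fun q ↦ A q (b q)) ∘ (extChartAt 𝓘(ℝ, E) p).symm) (extChartAt 𝓘(ℝ, E) p p) w =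
        fderiv ℝ (A ∘ (extChartAt 𝓘(ℝ, E) p).symm) (extChartAt 𝓘(ℝ, E) p p) w (b p) +
        A p (fderiv ℝ (b ∘ (extChartAt 𝓘(ℝ, E) p).symm) (extChartAt 𝓘(ℝ, E) p p) w) := by
    intro w
    have := fderiv_clm_apply (differentiableAt_comp_extChartAt_symm hA)
      (differentiableAt_comp_extChartAt_symm hb)
    simp only [Function.comp_def] at this ⊢
    rw [this]
    simp [add_comm]
  exact key v

section Base

variable [IsManifold 𝓘(ℝ, E) ∞ M]

theorem trivializationAt_self (p : M) (v : TangentSpace 𝓘(ℝ, E) p) :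
    (trivializationAt E (TangentSpace 𝓘(ℝ, E) : M → Type _) p (TotalSpace.mk' E p v)).2 = v := by
  rw [TangentBundle.trivializationAt_apply]
  exact (tangentBundleCore 𝓘(ℝ, E) M).coordChange_self (achart E p) p (mem_chart_source E p) v

theorem trivializationAt_symm_self (p : M) (v : E) :
    (trivializationAt E (TangentSpace 𝓘(ℝ, E) : M → Type _) p).symm p v = v := by
  have h := trivializationAt_self p
    ((trivializationAt E (TangentSpace 𝓘(ℝ, E) : M → Type _) p).symm p v)
  rw [← h]
  simp [Trivialization.apply_mk_symm _ (FiberBundle.mem_baseSet_trivializationAt' p)]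
  rfl

theorem ext_self {p : M} (v : TangentSpace 𝓘(ℝ, E) p) : ext v p = v :=
  FiberBundle.extend_apply_self E v

theorem diffAt_ext {p : M} (v : TangentSpace 𝓘(ℝ, E) p) : DiffAt (ext v) p :=
  FiberBundle.mdifferentiableAt_extend 𝓘(ℝ, E) E v

theorem trivializationAt_eq_continuousLinearMapAt (p : M) {q : M} (hq : q ∈ (chartAt E p).source)
    (v : TangentSpace 𝓘(ℝ, E) q) :
    (trivializationAt E (TangentSpace 𝓘(ℝ, E) : M → Type _) p (TotalSpace.mk' E q v)).2 =
      (trivializationAt E (TangentSpace 𝓘(ℝ, E) : M → Type _) p).continuousLinearMapAt ℝ q v := by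
  rw [Trivialization.continuousLinearMapAt_apply, Trivialization.coe_linearMapAt_of_mem _ hq]

/-- The tangent trivialization at `p` is the derivative of the chart, which inverts the derivative
of the inverse chart. This links Mathlib's bracket, defined by pullback, to trivialization
coordinates. -/
theorem mpullbackWithin_extChartAt_symm (X : VField E M) {p : M} {z : E}
    (hz : z ∈ (extChartAt 𝓘(ℝ, E) p).target) :
    VectorField.mpullbackWithin 𝓘(ℝ, E) 𝓘(ℝ, E) (extChartAt 𝓘(ℝ, E) p).symm X
      (Set.range 𝓘(ℝ, E)) z =
    (trivializationAt E (TangentSpace 𝓘(ℝ, E) : M → Type _) p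
      (TotalSpace.mk' E ((extChartAt 𝓘(ℝ, E) p).symm z)
        (X ((extChartAt 𝓘(ℝ, E) p).symm z)))).2 := by
  have hqs : (extChartAt 𝓘(ℝ, E) p).symm z ∈ (chartAt E p).source := by
    simpa using (extChartAt 𝓘(ℝ, E) p).map_target hz
  rw [trivializationAt_eq_continuousLinearMapAt p hqs,
    TangentBundle.continuousLinearMapAt_trivializationAt hqs, VectorField.mpullbackWithin_apply]
  have h3 := mfderivWithin_extChartAt_symm_comp_mfderiv_extChartAt (I := 𝓘(ℝ, E)) hz
  obtain ⟨L, hL⟩ := isInvertible_mfderivWithin_extChartAt_symm (I := 𝓘(ℝ, E)) hz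
  rw [← hL] at h3 ⊢
  rw [ContinuousLinearMap.inverse_equiv]
  exact (L.symm_apply_eq).2
    (DFunLike.congr_fun h3 (X ((extChartAt 𝓘(ℝ, E) p).symm z))).symm

theorem mlieBracket_eq_sub (X Y : VField E M) (p : M) (hX : DiffAt X p) (hY : DiffAt Y p) :
    VectorField.mlieBracket 𝓘(ℝ, E) X Y p =
      (mvfderiv 𝓘(ℝ, E) (fun q ↦ (trivializationAt E (TangentSpace 𝓘(ℝ, E) : M → Type _) p
          (TotalSpace.mk' E q (Y q))).2) p (X p)
      - mvfderiv 𝓘(ℝ, E) (fun q ↦ (trivializationAt E (TangentSpace 𝓘(ℝ, E) : M → Type _) p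
          (TotalSpace.mk' E q (X q))).2) p (Y p) : E) := by
  rw [mvfderiv_eq_fderiv ((mdifferentiableAt_totalSpace _ _).1 hX).2,
    mvfderiv_eq_fderiv ((mdifferentiableAt_totalSpace _ _).1 hY).2]
  have hev : ∀ Z : VField E M,
      VectorField.mpullbackWithin 𝓘(ℝ, E) 𝓘(ℝ, E) (extChartAt 𝓘(ℝ, E) p).symm Z
        (Set.range 𝓘(ℝ, E)) =ᶠ[nhds (extChartAt 𝓘(ℝ, E) p p)]
      (fun q ↦ (trivializationAt E (TangentSpace 𝓘(ℝ, E) : M → Type _) p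
          (TotalSpace.mk' E q (Z q))).2) ∘ (extChartAt 𝓘(ℝ, E) p).symm := fun Z ↦ by
    filter_upwards [extChartAt_target_mem_nhds (I := 𝓘(ℝ, E)) p] with z hz
    exact mpullbackWithin_extChartAt_symm Z hz
  have hval : ∀ Z : VField E M,
      VectorField.mpullbackWithin 𝓘(ℝ, E) 𝓘(ℝ, E) (extChartAt 𝓘(ℝ, E) p).symm Z
        (Set.range 𝓘(ℝ, E)) (extChartAt 𝓘(ℝ, E) p p) = Z p := fun Z ↦ by
    rw [(hev Z).self_of_nhds]
    refine Eq.trans ?_ (trivializationAt_self p (Z p))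
    rw [Function.comp_apply, extChartAt_to_inv]
  -- The preferred chart at `p` has derivative the identity of `T_p M = E` at `p`, so transporting
  -- the bracket back from the chart changes nothing.
  have hinv : ∀ A : E →L[ℝ] E, A = ContinuousLinearMap.id ℝ E → ∀ w, A.inverse w = w := by
    rintro A rfl w
    simp
  have huniv : ∀ (V₁ V₂ : E → E) (z : E), VectorField.lieBracketWithin ℝ V₁ V₂
      ((extChartAt 𝓘(ℝ, E) p).symm ⁻¹' Set.univ ∩ Set.range 𝓘(ℝ, E)) z =
      VectorField.lieBracket ℝ V₁ V₂ z := by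
    simp
  rw [← VectorField.mlieBracketWithin_univ, VectorField.mlieBracketWithin_apply]
  refine (hinv _ mfderiv_extChartAt_self _).trans ((huniv _ _ _).trans ?_)
  have hb := VectorField.lieBracket_eq (𝕜 := ℝ)
    (V := VectorField.mpullbackWithin 𝓘(ℝ, E) 𝓘(ℝ, E) (extChartAt 𝓘(ℝ, E) p).symm X
        (Set.range 𝓘(ℝ, E)))
    (W := VectorField.mpullbackWithin 𝓘(ℝ, E) 𝓘(ℝ, E) (extChartAt 𝓘(ℝ, E) p).symm Y
        (Set.range 𝓘(ℝ, E)))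
  have hb' := congrFun hb (extChartAt 𝓘(ℝ, E) p p)
  simp only [(hev X).fderiv_eq, (hev Y).fderiv_eq, hval X, hval Y] at hb'
  exact hb'


end Base

section Map

theorem eventually_mem_source {x : M → W} (hx : ContMDiff 𝓘(ℝ, E) 𝓘(ℝ, F) ∞ x) (p : M) :
    ∀ᶠ q in nhds p, q ∈ (chartAt E p).source ∧ x q ∈ (chartAt F (x p)).source :=
  Filter.Eventually.and ((chartAt E p).open_source.mem_nhds (mem_chart_source E p))
    (hx.continuous.continuousAt ((chartAt F (x p)).open_source.mem_nhds (mem_chart_source F (x p))))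

variable [IsManifold 𝓘(ℝ, E) ∞ M] [IsManifold 𝓘(ℝ, F) ∞ W]

/-- The differential of `x` read in the trivializations at `p` and `x p`. -/
noncomputable def coordDeriv (E F : Type*) [NormedAddCommGroup E] [NormedSpace ℝ E]
    [NormedAddCommGroup F] [NormedSpace ℝ F]
    {M : Type*} [TopologicalSpace M] [ChartedSpace E M]
    {W : Type*} [TopologicalSpace W] [ChartedSpace F W]
    [IsManifold 𝓘(ℝ, E) ∞ M] [IsManifold 𝓘(ℝ, F) ∞ W] (x : M → W) (p q : M) : E →L[ℝ] F :=
  inTangentCoordinates 𝓘(ℝ, E) 𝓘(ℝ, F) id x (mfderiv 𝓘(ℝ, E) 𝓘(ℝ, F) x) p q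

theorem contMDiffAt_coordDeriv {x : M → W} (hx : ContMDiff 𝓘(ℝ, E) 𝓘(ℝ, F) ∞ x) (p : M) :
    ContMDiffAt 𝓘(ℝ, E) 𝓘(ℝ, E →L[ℝ] F) ∞ (coordDeriv E F x p) p :=
  (hx p).mfderiv_const (by simp)

theorem coordDeriv_apply {x : M → W} {p q : M} (hq : q ∈ (chartAt E p).source)
    (hxq : x q ∈ (chartAt F (x p)).source) (v : TangentSpace 𝓘(ℝ, E) q) :
    coordDeriv E F x p q
      (trivializationAt E (TangentSpace 𝓘(ℝ, E) : M → Type _) p (TotalSpace.mk' E q v)).2 =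
    (trivializationAt F (TangentSpace 𝓘(ℝ, F) : W → Type _) (x p)
      (TotalSpace.mk' F (x q) (incl E F x q v))).2 := by
  rw [trivializationAt_eq_continuousLinearMapAt p hq,
    trivializationAt_eq_continuousLinearMapAt (x p) hxq]
  have : coordDeriv E F x p q =
    ((trivializationAt F (TangentSpace 𝓘(ℝ, F) : W → Type _) (x p)).continuousLinearMapAt ℝ (x q)).comp
     ((incl E F x q).comp ((trivializationAt E (TangentSpace 𝓘(ℝ, E) : M → Type _) p).symmL ℝ q)) :=
    rfl
  rw [this]
  simp only [ContinuousLinearMap.comp_apply]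
  rw [Trivialization.symmL_continuousLinearMapAt _ hq]

theorem coordDeriv_self {x : M → W} (p : M) : coordDeriv E F x p p = (incl E F x p : E →L[ℝ] F) := by
  refine ContinuousLinearMap.ext fun v : E ↦ ?_
  have h := coordDeriv_apply (E := E) (F := F) (x := x) (mem_chart_source E p) (mem_chart_source F (x p)) v
  rw [trivializationAt_self] at h
  exact (congrArg (coordDeriv E F x p p) (trivializationAt_self p v)).symm.trans h

/-- Near `p` both trivializations are chart derivatives, so the chain rule identifies the two sides.
The identity is needed on a neighbourhood, since it is differentiated once more to obtain the
Hessian of `x`. -/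
theorem coordDeriv_eventuallyEq {x : M → W} (hx : ContMDiff 𝓘(ℝ, E) 𝓘(ℝ, F) ∞ x) (p : M) :
    (coordDeriv E F x p) ∘ (extChartAt 𝓘(ℝ, E) p).symm =ᶠ[nhds (extChartAt 𝓘(ℝ, E) p p)]
      fderiv ℝ (writtenInExtChartAt 𝓘(ℝ, E) 𝓘(ℝ, F) p x) := by
  have hc := (continuousAt_extChartAt_symm (I := 𝓘(ℝ, E)) p).eventually
    (by rw [extChartAt_to_inv]; exact eventually_mem_source hx p)
  filter_upwards [extChartAt_target_mem_nhds (I := 𝓘(ℝ, E)) p, hc] with z hz hq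
  rw [Function.comp_apply, coordDeriv, inTangentCoordinates_eq_mfderiv_comp hq.1 hq.2]
  simp only [id]
  rw [(extChartAt 𝓘(ℝ, E) p).right_inv hz, ← mfderiv_eq_fderiv]
  have h1 : MDifferentiableAt 𝓘(ℝ, E) 𝓘(ℝ, E) (extChartAt 𝓘(ℝ, E) p).symm z := by
    have := mdifferentiableWithinAt_extChartAt_symm (I := 𝓘(ℝ, E)) hz
    simpa [mdifferentiableWithinAt_univ] using this
  have h2 : MDifferentiableAt 𝓘(ℝ, E) 𝓘(ℝ, F) x ((extChartAt 𝓘(ℝ, E) p).symm z) :=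
    (hx _).mdifferentiableAt (by simp)
  have h3 := mdifferentiableAt_extChartAt (I := 𝓘(ℝ, F)) hq.2
  have h4 := mfderiv_comp z (h3.comp _ h2) h1
  have h5 := mfderiv_comp _ h3 h2
  simp only [modelWithCornersSelf_coe, Set.range_id, mfderivWithin_univ]
  rw [h5] at h4
  exact h4.symm

/-- Equality of mixed second derivatives of `x` in charts; this is why the pulled-back connection
has no torsion along `x`. -/
theorem mvfderiv_coordDeriv_symm {x : M → W} (hx : ContMDiff 𝓘(ℝ, E) 𝓘(ℝ, F) ∞ x) (p : M)
    (u v : TangentSpace 𝓘(ℝ, E) p) :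
    mvfderiv 𝓘(ℝ, E) (coordDeriv E F x p) p u v = mvfderiv 𝓘(ℝ, E) (coordDeriv E F x p) p v u := by
  have hd := (contMDiffAt_coordDeriv hx p).mdifferentiableAt (by simp)
  rw [mvfderiv_eq_fderiv hd, mvfderiv_eq_fderiv hd, (coordDeriv_eventuallyEq hx p).fderiv_eq]
  have hs : ContDiffAt ℝ ∞ (writtenInExtChartAt 𝓘(ℝ, E) 𝓘(ℝ, F) p x) (extChartAt 𝓘(ℝ, E) p p) := by
    have := (contMDiffAt_iff.1 (hx p)).2
    simpa [contDiffWithinAt_univ] using! this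
  exact (hs.isSymmSndFDerivAt (by
    rw [minSmoothness_of_isRCLikeNormedField]; exact ENat.LEInfty.out)).eq u v

end Map

end Coordinates

/-! ### Sections of the ambient tangent bundle along `x`: the pulled-back connection is metric and
symmetric -/

section Along

variable {E : Type*} [NormedAddCommGroup E] [NormedSpace ℝ E]
  {M : Type*} [TopologicalSpace M] [ChartedSpace E M]
  {F : Type*} [NormedAddCommGroup F] [NormedSpace ℝ F]
  {W : Type*} [TopologicalSpace W] [ChartedSpace F W]

theorem incl_id (y : W) (w : TangentSpace 𝓘(ℝ, F) y) : incl F F (id : W → W) y w = w := by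
  rw [incl, mfderiv_id]
  rfl

variable [IsManifold 𝓘(ℝ, F) ∞ W]

/-- The bilinear form field `G` read in the trivialization at `y`. -/
noncomputable def coordForm (G : BilinField F W) (y q : W) : F →L[ℝ] F →L[ℝ] ℝ :=
  ContinuousLinearMap.inCoordinates F (TangentSpace 𝓘(ℝ, F) : W → Type _) (F →L[ℝ] ℝ)
    (fun q : W ↦ TangentSpace 𝓘(ℝ, F) q →L[ℝ] ℝ) y q y q (G q)

theorem IsSemiRiemannian.contMDiffAt_coordForm {G : BilinField F W} (hG : IsSemiRiemannian G)
    (y : W) : ContMDiffAt 𝓘(ℝ, F) 𝓘(ℝ, F →L[ℝ] F →L[ℝ] ℝ) ∞ (coordForm G y) y :=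
  ((contMDiffAt_hom_bundle _).1 (hG.smooth y)).2

theorem coordForm_apply_symm (G : BilinField F W) {y q : W} (hq : q ∈ (chartAt F y).source)
    (a b : F) :
    coordForm G y q a b =
      G q ((trivializationAt F (TangentSpace 𝓘(ℝ, F) : W → Type _) y).symm q a)
        ((trivializationAt F (TangentSpace 𝓘(ℝ, F) : W → Type _) y).symm q b) := by
  have h := inCoordinates_apply_eq₂ (𝕜 := ℝ) (F₁ := F) (E₁ := (TangentSpace 𝓘(ℝ, F) : W → Type _))
    (F₂ := F) (E₂ := (TangentSpace 𝓘(ℝ, F) : W → Type _)) (F₃ := ℝ) (E₃ := Bundle.Trivial W ℝ)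
    (x₀ := y) (x := q) (ϕ := G q) (v := a) (w := b) hq hq (Set.mem_univ _)
  refine Eq.trans h ?_
  rw [Trivialization.coe_linearMapAt_of_mem _ (Set.mem_univ _)]
  rfl

theorem coordForm_apply (G : BilinField F W) {y q : W} (hq : q ∈ (chartAt F y).source)
    (a b : TangentSpace 𝓘(ℝ, F) q) :
    coordForm G y q
      (trivializationAt F (TangentSpace 𝓘(ℝ, F) : W → Type _) y (TotalSpace.mk' F q a)).2
      (trivializationAt F (TangentSpace 𝓘(ℝ, F) : W → Type _) y (TotalSpace.mk' F q b)).2 =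
    G q a b := by
  rw [coordForm_apply_symm G hq]
  have h : ∀ c : TangentSpace 𝓘(ℝ, F) q,
      (trivializationAt F (TangentSpace 𝓘(ℝ, F) : W → Type _) y).symm q
        (trivializationAt F (TangentSpace 𝓘(ℝ, F) : W → Type _) y (TotalSpace.mk' F q c)).2 = c :=
    fun c ↦ Trivialization.symm_proj_apply _ (TotalSpace.mk' F q c) hq
  rw [h, h]

/-- The section `Z` of `TW` along `x` is differentiable at `p`. -/
def DiffAlong (E : Type*) [NormedAddCommGroup E] [NormedSpace ℝ E]
    {M : Type*} [TopologicalSpace M] [ChartedSpace E M] (x : M → W)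
    (Z : ∀ p : M, TangentSpace 𝓘(ℝ, F) (x p)) (p : M) : Prop :=
  MDifferentiableAt 𝓘(ℝ, E) (𝓘(ℝ, F).prod 𝓘(ℝ, F))
    (fun q ↦ (TotalSpace.mk' F (x q) (Z q) : TangentBundle 𝓘(ℝ, F) W)) p

/-- The section `Z` of `TW` along `x`, read in the trivialization at `x p`. -/
noncomputable def coordAlong (x : M → W) (Z : ∀ p : M, TangentSpace 𝓘(ℝ, F) (x p)) (p q : M) : F :=
  (trivializationAt F (TangentSpace 𝓘(ℝ, F) : W → Type _) (x p) (TotalSpace.mk' F (x q) (Z q))).2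

theorem coordAlong_self (x : M → W) (Z : ∀ p : M, TangentSpace 𝓘(ℝ, F) (x p)) (p : M) :
    coordAlong x Z p p = Z p :=
  trivializationAt_self (x p) (Z p)

section

variable {x : M → W} {Z : ∀ p : M, TangentSpace 𝓘(ℝ, F) (x p)} {p : M}

theorem diffAlong_iff : DiffAlong E x Z p ↔ MDifferentiableAt 𝓘(ℝ, E) 𝓘(ℝ, F) x p ∧
    MDifferentiableAt 𝓘(ℝ, E) 𝓘(ℝ, F) (coordAlong x Z p) p :=
  mdifferentiableAt_totalSpace _ _

/-- The derivative of the coordinates of the section `Z` of `TW` along `x`. -/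
noncomputable def coordAlongDeriv (x : M → W) (Z : ∀ p : M, TangentSpace 𝓘(ℝ, F) (x p)) (p : M)
    (v : TangentSpace 𝓘(ℝ, E) p) : TangentSpace 𝓘(ℝ, F) (x p) :=
  mvfderiv 𝓘(ℝ, E) (coordAlong x Z p) p v

theorem derivAlong_eq [FiniteDimensional ℝ F]
    (D : CovariantDerivative 𝓘(ℝ, F) F (TangentSpace 𝓘(ℝ, F) : W → Type _))
    (v : TangentSpace 𝓘(ℝ, E) p) :
    derivAlong D x Z p v = coordAlongDeriv x Z p v + D (ext (Z p)) (x p) (incl E F x p v) := by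
  unfold derivAlong
  congr 1
  exact trivializationAt_symm_self (x p) _

end

variable {x : M → W} {Z₁ Z₂ : ∀ p : M, TangentSpace 𝓘(ℝ, F) (x p)} {p : M} {G : BilinField F W}

theorem eventually_apply_eq_coordForm (hx : ContinuousAt x p) :
    (fun q ↦ G (x q) (Z₁ q) (Z₂ q)) =ᶠ[nhds p]
      fun q ↦ coordForm G (x p) (x q) (coordAlong x Z₁ p q) (coordAlong x Z₂ p q) := by
  filter_upwards [hx ((chartAt F (x p)).open_source.mem_nhds (mem_chart_source F (x p)))] with q hq
  exact (coordForm_apply G hq _ _).symm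

theorem mdifferentiableAt_apply_along (hG : IsSemiRiemannian G)
    (h₁ : DiffAlong E x Z₁ p) (h₂ : DiffAlong E x Z₂ p) :
    MDifferentiableAt 𝓘(ℝ, E) 𝓘(ℝ, ℝ) (fun q ↦ G (x q) (Z₁ q) (Z₂ q)) p := by
  have hx := (diffAlong_iff.1 h₁).1
  have hA := ((hG.contMDiffAt_coordForm (x p)).mdifferentiableAt (by simp)).comp p hx
  exact ((hA.clm_apply (diffAlong_iff.1 h₁).2).clm_apply
    (diffAlong_iff.1 h₂).2).congr_of_eventuallyEq (eventually_apply_eq_coordForm hx.continuousAt)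

/-- The chart-constant extensions have constant coordinates `a`, `b`, so only the coefficients of
`G` are differentiated. -/
theorem mvfderiv_coordForm (hG : IsSemiRiemannian G) (y : W) (w : TangentSpace 𝓘(ℝ, F) y)
    (a b : TangentSpace 𝓘(ℝ, F) y) :
    mvfderiv 𝓘(ℝ, F) (coordForm G y) y w a b =
      mvfderiv 𝓘(ℝ, F) (fun q ↦ G q (ext a q) (ext b q)) y w := by
  have hA := (hG.contMDiffAt_coordForm y).mdifferentiableAt (by simp)
  have hc : ∀ c : F, MDifferentiableAt 𝓘(ℝ, F) 𝓘(ℝ, F) (fun _ : W ↦ c) y :=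
    fun c ↦ mdifferentiableAt_const
  have h1 : (fun q ↦ G q (ext a q) (ext b q)) =ᶠ[nhds y]
      fun q ↦ coordForm G y q (a : F) (b : F) := by
    filter_upwards [(chartAt F y).open_source.mem_nhds (mem_chart_source F y)] with q hq
    have ha : ∀ a : TangentSpace 𝓘(ℝ, F) y, ext a q =
        (trivializationAt F (TangentSpace 𝓘(ℝ, F) : W → Type _) y).symm q (a : F) := fun a ↦ by
      rw [ext, FiberBundle.extend, ← TotalSpace.mk', trivializationAt_self]
    rw [ha, ha]
    exact (coordForm_apply_symm G hq a b).symm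
  have h2 : ∀ a b : F, mvfderiv 𝓘(ℝ, F) (fun q ↦ coordForm G y q a b) y w =
      mvfderiv 𝓘(ℝ, F) (coordForm G y) y w a b := fun a b ↦ by
    rw [mvfderiv_clm_apply (hA.clm_apply (hc a)) (hc b),
      mvfderiv_clm_apply hA (hc a), mvfderiv_const, mvfderiv_const]
    simp
  exact (h2 a b).symm.trans (mvfderiv_congr h1 w).symm

/-- Product rule in the trivialization at `x p`. The derivative of the coefficients of `G` is
written with chart-constant fields, to which metric compatibility of `D` applies directly. -/
theorem mvfderiv_apply_along (hG : IsSemiRiemannian G)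
    (h₁ : DiffAlong E x Z₁ p) (h₂ : DiffAlong E x Z₂ p) (v : TangentSpace 𝓘(ℝ, E) p) :
    mvfderiv 𝓘(ℝ, E) (fun q ↦ G (x q) (Z₁ q) (Z₂ q)) p v =
      mvfderiv 𝓘(ℝ, F) (fun q ↦ G q (ext (Z₁ p) q) (ext (Z₂ p) q)) (x p) (incl E F x p v)
      + G (x p) (coordAlongDeriv x Z₁ p v) (Z₂ p)
      + G (x p) (Z₁ p) (coordAlongDeriv x Z₂ p v) := by
  obtain ⟨hx, h₁'⟩ := diffAlong_iff.1 h₁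
  obtain ⟨-, h₂'⟩ := diffAlong_iff.1 h₂
  have hB := (hG.contMDiffAt_coordForm (x p)).mdifferentiableAt (by simp)
  have hA := hB.comp p hx
  have hs : ∀ a b : F, coordForm G (x p) (x p) a b = G (x p) a b := fun a b ↦ by
    rw [coordForm_apply_symm G (mem_chart_source F (x p)), trivializationAt_symm_self,
      trivializationAt_symm_self]
  rw [mvfderiv_congr (eventually_apply_eq_coordForm hx.continuousAt), ← mvfderiv_coordForm hG]
  have e1 := mvfderiv_clm_apply (hA.clm_apply h₁') h₂' v
  have e2 := mvfderiv_clm_apply hA h₁' v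
  have e3 : mvfderiv 𝓘(ℝ, E) (coordForm G (x p) ∘ x) p v = 
    mvfderiv 𝓘(ℝ, F) (coordForm G (x p)) (x p) (incl E F x p v) := mfderiv_comp_apply p hB hx v
  rw [e2, e3] at e1
  -- The tangent space at `x p` and the model space `F` agree only by unfolding; stating the algebra
  -- over `F` avoids rewriting across that identification.
  have key : ∀ (A' C C' : F →L[ℝ] F →L[ℝ] ℝ) (_ : ∀ a b, C a b = C' a b) (c₁ z₁ d₁ c₂ z₂ d₂ : F)
      (_ : c₁ = z₁) (_ : c₂ = z₂),
      (A' c₁ + C d₁) c₂ + C c₁ d₂ = A' z₁ z₂ + C' d₁ z₂ + C' z₁ d₂ := by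
    rintro A' C C' hC c₁ _ d₁ c₂ _ d₂ rfl rfl
    simp [hC]
  exact e1.trans (key _ _ _ hs _ _ _ _ _ _ (coordAlong_self x Z₁ p) (coordAlong_self x Z₂ p))

theorem coordAlongDeriv_ext {y : W} (u w : TangentSpace 𝓘(ℝ, F) y) :
    coordAlongDeriv (E := F) id (ext u) y w = 0 := by
  have h : coordAlong (id : W → W) (ext u) y =ᶠ[nhds y] fun _ ↦ (u : F) := by
    filter_upwards [(chartAt F y).open_source.mem_nhds (mem_chart_source F y)] with q hq
    refine Eq.trans ?_ (trivializationAt_self y u)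
    rw [coordAlong, ext, FiberBundle.extend]
    have := congrArg Prod.snd (Trivialization.apply_mk_symm
      (trivializationAt F (TangentSpace 𝓘(ℝ, F) : W → Type _) y) hq
      (trivializationAt F (TangentSpace 𝓘(ℝ, F) : W → Type _) y (TotalSpace.mk' F y u)).2)
    exact this
  have hc : ∀ c : F, mvfderiv 𝓘(ℝ, F) (fun _ : W ↦ c) y w = 0 := fun c ↦ by
    rw [mvfderiv_const]
    rfl
  exact (mvfderiv_congr h w).trans (hc u)

section

variable [IsManifold 𝓘(ℝ, E) ∞ M]

theorem coordAlong_incl_eventuallyEq (hx : ContMDiff 𝓘(ℝ, E) 𝓘(ℝ, F) ∞ x) (Y : VField E M) (p : M) :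
    coordAlong x (fun q ↦ incl E F x q (Y q)) p =ᶠ[nhds p]
      fun q ↦ coordDeriv E F x p q (coordAlong id Y p q) := by
  filter_upwards [eventually_mem_source hx p] with q hq
  exact (coordDeriv_apply hq.1 hq.2 (Y q)).symm

theorem DiffAt.diffAlong_incl (hx : ContMDiff 𝓘(ℝ, E) 𝓘(ℝ, F) ∞ x) {Y : VField E M} {p : M}
    (hY : DiffAt Y p) : DiffAlong E x (fun q ↦ incl E F x q (Y q)) p := by
  refine diffAlong_iff.2 ⟨(hx p).mdifferentiableAt (by simp), ?_⟩
  exact (((contMDiffAt_coordDeriv hx p).mdifferentiableAt (by simp)).clm_apply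
    (diffAlong_iff (E := E) (x := id).1 hY).2).congr_of_eventuallyEq
      (coordAlong_incl_eventuallyEq hx Y p)

end

variable [FiniteDimensional ℝ F]
  {D : CovariantDerivative 𝓘(ℝ, F) F (TangentSpace 𝓘(ℝ, F) : W → Type _)}

theorem IsLeviCivita.mvfderiv_along (hD : IsLeviCivita G D) (hG : IsSemiRiemannian G)
    (h₁ : DiffAlong E x Z₁ p) (h₂ : DiffAlong E x Z₂ p) (v : TangentSpace 𝓘(ℝ, E) p) :
    mvfderiv 𝓘(ℝ, E) (fun q ↦ G (x q) (Z₁ q) (Z₂ q)) p v =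
      G (x p) (derivAlong D x Z₁ p v) (Z₂ p) + G (x p) (Z₁ p) (derivAlong D x Z₂ p v) := by
  rw [mvfderiv_apply_along hG h₁ h₂, hD.metric _ _ _ _ (diffAt_ext _) (diffAt_ext _),
    derivAlong_eq, derivAlong_eq, ext_self, ext_self]
  simp only [map_add, add_apply]
  ring

/-- Both derivatives satisfy the same Leibniz rule for `G(S, ext u)` and coincide on `ext u`, whose
coordinates are constant. Nondegeneracy of `G` then forces them to coincide on `S`, with no frame
expansion of the connection. -/
theorem IsLeviCivita.derivAlong_id (hD : IsLeviCivita G D) (hG : IsSemiRiemannian G)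
    {S : VField F W} {y : W} (hS : DiffAt S y) (w : TangentSpace 𝓘(ℝ, F) y) :
    derivAlong (E := F) D id S y w = D S y w := by
  rw [← sub_eq_zero]
  refine hG.nondeg y _ fun u ↦ ?_
  have h1 := hD.mvfderiv_along (E := F) (x := id) (Z₁ := S) (Z₂ := ext u) (p := y) hG hS
    (diffAt_ext u) w
  have h2 := hD.metric y S (ext u) w hS (diffAt_ext u)
  have h3 : derivAlong (E := F) D id (ext u) y w = D (ext u) y w := by
    rw [derivAlong_eq, coordAlongDeriv_ext, zero_add, incl_id]
    exact congrArg (fun u' : TangentSpace 𝓘(ℝ, F) y ↦ D (ext u') y w) (ext_self u)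
  rw [map_sub, sub_apply, sub_eq_zero]
  have h4 := h1.symm.trans h2
  rw [h3, ext_self] at h4
  exact add_right_cancel h4

theorem IsLeviCivita.derivAlong_comp (hD : IsLeviCivita G D) (hG : IsSemiRiemannian G)
    {S : VField F W} (hx : MDifferentiableAt 𝓘(ℝ, E) 𝓘(ℝ, F) x p) (hS : DiffAt S (x p))
    (v : TangentSpace 𝓘(ℝ, E) p) :
    derivAlong D x (fun q ↦ S (x q)) p v = D S (x p) (incl E F x p v) := by
  have h : coordAlongDeriv x (fun q ↦ S (x q)) p v =
      coordAlongDeriv (E := F) id S (x p) (incl E F x p v) :=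
    mfderiv_comp_apply p (diffAlong_iff (E := F) (x := id).1 hS).2 hx v
  rw [← hD.derivAlong_id hG hS, derivAlong_eq, derivAlong_eq, h, incl_id]
  rfl

variable [IsManifold 𝓘(ℝ, E) ∞ M]

/-- The second derivative of `x` read in the trivializations at `p` and `x p`. -/
noncomputable def coordHess (x : M → W) (p : M) (v w : TangentSpace 𝓘(ℝ, E) p) :
    TangentSpace 𝓘(ℝ, F) (x p) :=
  mvfderiv 𝓘(ℝ, E) (coordDeriv E F x p) p v w

theorem coordAlongDeriv_incl (hx : ContMDiff 𝓘(ℝ, E) 𝓘(ℝ, F) ∞ x) {Y : VField E M} {p : M}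
    (hY : DiffAt Y p) (v : TangentSpace 𝓘(ℝ, E) p) :
    coordAlongDeriv x (fun q ↦ incl E F x q (Y q)) p v =
      coordHess x p v (Y p) +
      incl E F x p (coordAlongDeriv id Y p v) := by
  refine (mvfderiv_congr (coordAlong_incl_eventuallyEq hx Y p) v).trans ?_
  rw [mvfderiv_clm_apply ((contMDiffAt_coordDeriv hx p).mdifferentiableAt (by simp))
    (diffAlong_iff (E := E) (x := id).1 hY).2, coordDeriv_self, coordAlong_self]
  rfl

/-- In coordinates the derivative of `dx(Y)` along `X` is a Hessian term, plus `dx` of the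
coordinate derivative of `Y`, plus a connection term. The Hessian terms cancel by symmetry, the
connection terms cancel because chart-constant fields commute and `D` has no torsion, and the middle
terms leave the bracket. -/
theorem IsLeviCivita.derivAlong_symm (hD : IsLeviCivita G D)
    (hx : ContMDiff 𝓘(ℝ, E) 𝓘(ℝ, F) ∞ x) {X Y : VField E M} {p : M}
    (hX : DiffAt X p) (hY : DiffAt Y p) :
    derivAlong D x (fun q ↦ incl E F x q (Y q)) p (X p) -
      derivAlong D x (fun q ↦ incl E F x q (X q)) p (Y p) =
    incl E F x p (VectorField.mlieBracket 𝓘(ℝ, E) X Y p) := by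
  have hbr : ∀ u v : TangentSpace 𝓘(ℝ, F) (x p),
      VectorField.mlieBracket 𝓘(ℝ, F) (ext u) (ext v) (x p) = 0 := fun u v ↦ by
    have h := mlieBracket_eq_sub (ext u) (ext v) (x p) (diffAt_ext u) (diffAt_ext v)
    have h1 := coordAlongDeriv_ext v (ext u (x p))
    have h2 := coordAlongDeriv_ext u (ext v (x p))
    refine h.trans ?_
    refine (congrArg₂ (fun a b : F ↦ a - b) h1 h2).trans (sub_zero _)
  have htor := hD.torsion_free (x p) (ext (incl E F x p (X p))) (ext (incl E F x p (Y p)))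
    (diffAt_ext _) (diffAt_ext _)
  rw [hbr, ext_self, ext_self] at htor
  have hsymm : coordHess (F := F) x p (Y p) (X p) = coordHess x p (X p) (Y p) :=
    mvfderiv_coordDeriv_symm hx p (Y p) (X p)
  have hb : VectorField.mlieBracket 𝓘(ℝ, E) X Y p =
      coordAlongDeriv id Y p (X p) - coordAlongDeriv id X p (Y p) :=
    mlieBracket_eq_sub X Y p hX hY
  rw [derivAlong_eq, derivAlong_eq, coordAlongDeriv_incl hx hX, coordAlongDeriv_incl hx hY, hb,
    map_sub, hsymm, sub_eq_zero.1 htor]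
  abel

end Along

/-! ### Linear algebra of the splitting of `TW` along `M` -/

section Pointwise

variable {E : Type*} [NormedAddCommGroup E] [NormedSpace ℝ E]
  {M : Type*} [TopologicalSpace M] [ChartedSpace E M]
  {F : Type*} [NormedAddCommGroup F] [NormedSpace ℝ F]
  {W : Type*} [TopologicalSpace W] [ChartedSpace F W]
  {x : M → W} {G : BilinField F W} {N : VField F W} {α : M → ℝ}

theorem pullMetric_apply (p : M) (u v : TangentSpace 𝓘(ℝ, E) p) :
    pullMetric x G p u v = G (x p) (incl E F x p u) (incl E F x p v) := rfl

theorem rigForm_apply (p : M) (u : TangentSpace 𝓘(ℝ, E) p) :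
    rigForm x G N p u = G (x p) (N (x p)) (incl E F x p u) := rfl

theorem assocMetric_apply (g : BilinField E M) (η : FormField E M) (p : M)
    (u v : TangentSpace 𝓘(ℝ, E) p) :
    assocMetric g α η p u v = g p u v + α p * (η p u * η p v) := rfl

/-- The map `(u, b) ↦ A u + b n` is injective because `n` is not in the range of `A`, and source and
target have equal dimension. -/
theorem exists_eq_add_smul_of_notMem_range [FiniteDimensional ℝ E] [FiniteDimensional ℝ F]
    (hdim : Module.finrank ℝ F = Module.finrank ℝ E + 1) {A : E →L[ℝ] F}
    (hA : Function.Injective A) {n : F} (hn : n ∉ Set.range A) (w : F) :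
    ∃ c : E × ℝ, w = A c.1 + c.2 • n := by
  let L : (E × ℝ) →ₗ[ℝ] F := LinearMap.coprod A.toLinearMap (LinearMap.toSpanSingleton ℝ F n)
  have hL : ∀ c, L c = A c.1 + c.2 • n := fun c ↦ by simp [L]
  have hinj : Function.Injective L := by
    rw [injective_iff_map_eq_zero]
    rintro ⟨u, b⟩ h
    rw [hL] at h
    have hb : b = 0 := by
      by_contra hb
      refine hn ⟨(-b⁻¹) • u, ?_⟩
      rw [map_smul, eq_neg_of_add_eq_zero_left h, smul_neg, neg_smul, neg_neg, smul_smul,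
        inv_mul_cancel₀ hb, one_smul]
    subst hb
    rw [zero_smul, add_zero] at h
    exact Prod.ext (hA (h.trans (map_zero A).symm)) rfl
  obtain ⟨c, h⟩ := (LinearMap.injective_iff_surjective_of_finrank_eq_finrank (by
      rw [Module.finrank_prod, hdim, Module.finrank_self])).1 hinj w
  exact ⟨c, h.symm.trans (hL c)⟩

theorem contDiff_precomp (V : Type*) [NormedAddCommGroup V] [NormedSpace ℝ V] :
    ContDiff ℝ ∞ (fun A : E →L[ℝ] F ↦ (ContinuousLinearMap.compL ℝ E F V).flip A) :=
  ContinuousLinearMap.contDiff _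

theorem contDiff_smulRight (V : Type*) [NormedAddCommGroup V] [NormedSpace ℝ V] :
    ContDiff ℝ ∞ (fun t : (E →L[ℝ] ℝ) × V ↦ t.1.smulRight t.2) :=
  isBoundedBilinearMap_smulRight.contDiff

end Pointwise

/-! ### Smoothness of `η` and of the associated metric -/

section Smoothness

variable {E : Type*} [NormedAddCommGroup E] [NormedSpace ℝ E]
  {M : Type*} [TopologicalSpace M] [ChartedSpace E M]
  {F : Type*} [NormedAddCommGroup F] [NormedSpace ℝ F]
  {W : Type*} [TopologicalSpace W] [ChartedSpace F W] [IsManifold 𝓘(ℝ, F) ∞ W]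
  {x : M → W} {G : BilinField F W} {O : Set W} {N : VField F W} {α : M → ℝ}

theorem IsNullRigging.contMDiffAt (hN : IsNullRigging E F x G O N) (p : M) :
    ContMDiffAt 𝓘(ℝ, F) (𝓘(ℝ, F).prod 𝓘(ℝ, F)) ∞
      (fun q ↦ (TotalSpace.mk' F q (N q) : TangentBundle 𝓘(ℝ, F) W)) (x p) :=
  hN.smooth.contMDiffAt (hN.isOpen.mem_nhds (hN.mem p))

theorem IsNullRigging.diffAt (hN : IsNullRigging E F x G O N) (p : M) : DiffAt N (x p) :=
  (hN.contMDiffAt p).mdifferentiableAt (by simp)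

theorem contMDiffAt_coordForm_comp (hG : IsSemiRiemannian G) (hx : ContMDiff 𝓘(ℝ, E) 𝓘(ℝ, F) ∞ x)
    (p : M) : ContMDiffAt 𝓘(ℝ, E) 𝓘(ℝ, F →L[ℝ] F →L[ℝ] ℝ) ∞
      (fun q ↦ coordForm G (x p) (x q)) p :=
  (hG.contMDiffAt_coordForm (x p)).comp p (hx p)

variable [IsManifold 𝓘(ℝ, E) ∞ M]

/-- The `1`-form `η` read in the trivialization at `p`. -/
noncomputable def coordRigForm (E : Type*) [NormedAddCommGroup E] [NormedSpace ℝ E]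
    {M : Type*} [TopologicalSpace M] [ChartedSpace E M] [IsManifold 𝓘(ℝ, E) ∞ M]
    (x : M → W) (G : BilinField F W) (N : VField F W) (p q : M) : E →L[ℝ] ℝ :=
  (coordForm G (x p) (x q) (coordAlong x (fun q ↦ N (x q)) p q)).comp (coordDeriv E F x p q)

theorem contMDiffAt_coordRigForm (hG : IsSemiRiemannian G) (hx : ContMDiff 𝓘(ℝ, E) 𝓘(ℝ, F) ∞ x)
    (hN : IsNullRigging E F x G O N) (p : M) :
    ContMDiffAt 𝓘(ℝ, E) 𝓘(ℝ, E →L[ℝ] ℝ) ∞ (coordRigForm E x G N p) p := by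
  have hNx : ContMDiffAt 𝓘(ℝ, E) 𝓘(ℝ, F) ∞ (coordAlong x (fun q ↦ N (x q)) p) p :=
    (((contMDiffAt_totalSpace).1 (hN.contMDiffAt p)).2).comp p (hx p)
  exact ((contMDiffAt_coordForm_comp hG hx p).clm_apply hNx).clm_comp (contMDiffAt_coordDeriv hx p)

theorem trivializationAt_symm_apply {p q : M} (hq : q ∈ (chartAt E p).source) (a : E) :
    (trivializationAt E (TangentSpace 𝓘(ℝ, E) : M → Type _) p (TotalSpace.mk' E q
      ((trivializationAt E (TangentSpace 𝓘(ℝ, E) : M → Type _) p).symm q a))).2 = a :=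
  congrArg Prod.snd (Trivialization.apply_mk_symm
    (trivializationAt E (TangentSpace 𝓘(ℝ, E) : M → Type _) p) hq a)

theorem coordDeriv_eq {p q : M} (hq : q ∈ (chartAt E p).source)
    (hxq : x q ∈ (chartAt F (x p)).source) (a : E) :
    coordDeriv E F x p q a = (trivializationAt F (TangentSpace 𝓘(ℝ, F) : W → Type _) (x p)
      (TotalSpace.mk' F (x q) (incl E F x q
        ((trivializationAt E (TangentSpace 𝓘(ℝ, E) : M → Type _) p).symm q a)))).2 := by
  rw [← coordDeriv_apply hq hxq, trivializationAt_symm_apply hq]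

theorem coordRigForm_eq {p q : M} (hq : q ∈ (chartAt E p).source)
    (hxq : x q ∈ (chartAt F (x p)).source) (a : E) :
    coordRigForm E x G N p q a =
      rigForm x G N q ((trivializationAt E (TangentSpace 𝓘(ℝ, E) : M → Type _) p).symm q a) := by
  rw [coordRigForm, ContinuousLinearMap.comp_apply, coordDeriv_eq hq hxq, coordAlong,
    coordForm_apply G hxq]
  rfl

theorem contMDiffAt_coordForm_assocMetric (hG : IsSemiRiemannian G)
    (hx : ContMDiff 𝓘(ℝ, E) 𝓘(ℝ, F) ∞ x) (hN : IsNullRigging E F x G O N)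
    (hα : ContMDiff 𝓘(ℝ, E) 𝓘(ℝ, ℝ) ∞ α) (p : M) :
    ContMDiffAt 𝓘(ℝ, E) 𝓘(ℝ, E →L[ℝ] E →L[ℝ] ℝ) ∞
      (coordForm (assocMetric (pullMetric (E := E) x G) α (rigForm x G N)) p) p := by
  have hJ := contMDiffAt_coordDeriv (E := E) hx p
  have hη := contMDiffAt_coordRigForm hG hx hN p
  have h1 : ContMDiffAt 𝓘(ℝ, E) 𝓘(ℝ, E →L[ℝ] E →L[ℝ] ℝ) ∞ (fun q ↦
      (((ContinuousLinearMap.compL ℝ E F ℝ).flip (coordDeriv E F x p q)).comp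
        ((coordForm G (x p) (x q)).comp (coordDeriv E F x p q))) +
      α q • (coordRigForm E x G N p q).smulRight (coordRigForm E x G N p q)) p := by
    have h2 := ((contDiff_precomp ℝ).contMDiff.contMDiffAt.comp p hJ).clm_comp
      ((contMDiffAt_coordForm_comp hG hx p).clm_comp hJ)
    have h3 := (contDiff_smulRight (E →L[ℝ] ℝ)).contMDiff.contMDiffAt.comp p
      (hη.prodMk_space hη)
    exact h2.add ((hα p).smul h3)
  refine h1.congr_of_eventuallyEq ?_
  filter_upwards [eventually_mem_source hx p] with q hq
  ext a b
  rw [coordForm_apply_symm _ hq.1, assocMetric_apply, ← coordRigForm_eq hq.1 hq.2,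
    ← coordRigForm_eq hq.1 hq.2, pullMetric_apply, ← coordForm_apply G hq.2,
    ← coordDeriv_eq hq.1 hq.2, ← coordDeriv_eq hq.1 hq.2]
  simp

end Smoothness

/-! ### The rigged field, and `gα` as a semi-Riemannian metric -/

section Rigging

variable {E : Type*} [NormedAddCommGroup E] [NormedSpace ℝ E] [FiniteDimensional ℝ E]
  {M : Type*} [TopologicalSpace M] [ChartedSpace E M]
  {F : Type*} [NormedAddCommGroup F] [NormedSpace ℝ F] [FiniteDimensional ℝ F]
  {W : Type*} [TopologicalSpace W] [ChartedSpace F W] [IsManifold 𝓘(ℝ, F) ∞ W]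
  {x : M → W} {G : BilinField F W} {O : Set W} {N : VField F W} {α : M → ℝ}

theorem IsNullRigging.exists_split (hdim : Module.finrank ℝ F = Module.finrank ℝ E + 1)
    (hx : IsSubmanifold E F x) (hN : IsNullRigging E F x G O N) (p : M)
    (w : TangentSpace 𝓘(ℝ, F) (x p)) :
    ∃ c : TangentSpace 𝓘(ℝ, E) p × ℝ, w = incl E F x p c.1 + c.2 • N (x p) :=
  exists_eq_add_smul_of_notMem_range hdim (A := (incl E F x p : E →L[ℝ] F)) (hx.immersion p)
    (hN.transversal p) w

theorem IsNullRigging.split_spec (hdim : Module.finrank ℝ F = Module.finrank ℝ E + 1)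
    (hx : IsSubmanifold E F x) (hN : IsNullRigging E F x G O N) (p : M)
    (w : TangentSpace 𝓘(ℝ, F) (x p)) :
    w = incl E F x p (split (E := E) x N p w).1 + (split (E := E) x N p w).2 • N (x p) :=
  Classical.epsilon_spec (hN.exists_split hdim hx p w)

theorem eq_zero_of_pullMetric_of_rigForm (hdim : Module.finrank ℝ F = Module.finrank ℝ E + 1)
    (hG : IsSemiRiemannian G) (hx : IsSubmanifold E F x) (hN : IsNullRigging E F x G O N) {p : M}
    {u : TangentSpace 𝓘(ℝ, E) p} (hu : ∀ v, pullMetric x G p u v = 0)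
    (hηu : rigForm x G N p u = 0) : u = 0 := by
  have h : incl E F x p u = 0 := by
    refine hG.nondeg (x p) _ fun w ↦ ?_
    obtain ⟨c, hc⟩ := hN.exists_split hdim hx p w
    have h1 := hu c.1
    rw [pullMetric_apply] at h1
    rw [rigForm_apply, hG.symm] at hηu
    rw [hc, map_add, map_smul, h1, hηu, smul_zero, add_zero]
  exact hx.immersion p (h.trans (map_zero _).symm)

/-- A nonzero radical vector has nonzero `η`, since it would otherwise be orthogonal to `TM` and to
`N`; rescaling gives `η = 1`. -/
theorem rigged_spec (hdim : Module.finrank ℝ F = Module.finrank ℝ E + 1)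
    (hG : IsSemiRiemannian G) (hx : IsSubmanifold E F x) (hN : IsNullRigging E F x G O N)
    (hnull : IsNull (pullMetric (E := E) x G)) (p : M) :
    (∀ w, pullMetric (E := E) x G p (rigged x G N p) w = 0) ∧
      rigForm (E := E) x G N p (rigged x G N p) = 1 := by
  refine Classical.epsilon_spec (p := fun v : TangentSpace 𝓘(ℝ, E) p ↦
    (∀ w, pullMetric (E := E) x G p v w = 0) ∧ rigForm (E := E) x G N p v = 1) ?_
  obtain ⟨u, hu0, hu⟩ := hnull p
  have hη : rigForm (E := E) x G N p u ≠ 0 := fun h ↦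
    hu0 (eq_zero_of_pullMetric_of_rigForm hdim hG hx hN hu h)
  refine ⟨(rigForm (E := E) x G N p u)⁻¹ • u, fun w ↦ ?_, ?_⟩
  · rw [map_smul, smul_apply, hu, smul_zero]
  · rw [map_smul, smul_eq_mul, inv_mul_cancel₀ hη]

variable [IsManifold 𝓘(ℝ, E) ∞ M]

theorem isSemiRiemannian_assocMetric (hdim : Module.finrank ℝ F = Module.finrank ℝ E + 1)
    (hG : IsSemiRiemannian G) (hx : IsSubmanifold E F x) (hN : IsNullRigging E F x G O N)
    (hnull : IsNull (pullMetric (E := E) x G)) (hα : ContMDiff 𝓘(ℝ, E) 𝓘(ℝ, ℝ) ∞ α)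
    (hα0 : ∀ p, α p ≠ 0) :
    IsSemiRiemannian (assocMetric (pullMetric (E := E) x G) α (rigForm x G N)) where
  smooth p := (contMDiffAt_hom_bundle _).2
    ⟨contMDiffAt_id, contMDiffAt_coordForm_assocMetric hG hx.smooth hN hα p⟩
  symm p u v := by
    rw [assocMetric_apply, assocMetric_apply, pullMetric_apply, pullMetric_apply, hG.symm, mul_comm
      (rigForm x G N p u)]
  nondeg p u hu := by
    obtain ⟨hξ, hηξ⟩ := rigged_spec hdim hG hx hN hnull p
    have h1 := hu (rigged x G N p)
    rw [assocMetric_apply, pullMetric_apply, hG.symm, ← pullMetric_apply, hξ, hηξ, zero_add,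
      mul_one] at h1
    have hη := (mul_eq_zero.1 h1).resolve_left (hα0 p)
    refine eq_zero_of_pullMetric_of_rigForm hdim hG hx hN (fun v ↦ ?_) hη
    have h2 := hu v
    rwa [assocMetric_apply, hη, zero_mul, mul_zero, add_zero] at h2

theorem IsSemiRiemannian.isInvertible_coordForm {g : BilinField E M} (hg : IsSemiRiemannian g)
    {p q : M} (hq : q ∈ (chartAt E p).source) : (coordForm g p q).IsInvertible := by
  have hinj : Function.Injective (coordForm g p q) := by
    rw [injective_iff_map_eq_zero]
    intro a ha
    have h := hg.nondeg q ((trivializationAt E (TangentSpace 𝓘(ℝ, E) : M → Type _) p).symm q a)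
      fun v ↦ by
        rw [← coordForm_apply g hq, trivializationAt_symm_apply hq, ha]
        rfl
    rw [← trivializationAt_symm_apply hq a, h, trivializationAt_eq_continuousLinearMapAt p hq,
      map_zero]
  have hfr : Module.finrank ℝ E = Module.finrank ℝ (E →L[ℝ] ℝ) := by
    rw [← (LinearMap.toContinuousLinearMap (𝕜 := ℝ) (E := E) (F' := ℝ)).finrank_eq]
    exact (Subspace.dual_finrank_eq (K := ℝ) (V := E)).symm
  refine ⟨(LinearEquiv.ofInjectiveOfFinrankEq (coordForm g p q).toLinearMap hinj
    hfr).toContinuousLinearEquiv, ?_⟩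
  ext
  rfl

/-- For `α = 1` the associated metric satisfies `g₁(ξ, ·) = η`, so in coordinates `ξ` is the inverse
of the matrix of `g₁` applied to `η`, and operator inversion is smooth. -/
theorem diffAt_rigged (hdim : Module.finrank ℝ F = Module.finrank ℝ E + 1)
    (hG : IsSemiRiemannian G) (hx : IsSubmanifold E F x) (hN : IsNullRigging E F x G O N)
    (hnull : IsNull (pullMetric (E := E) x G)) (p : M) :
    DiffAt (rigged (E := E) x G N) p := by
  have h1 : ContMDiff 𝓘(ℝ, E) 𝓘(ℝ, ℝ) ∞ (fun _ : M ↦ (1 : ℝ)) := contMDiff_const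
  have hg := isSemiRiemannian_assocMetric hdim hG hx hN hnull h1 (fun _ ↦ one_ne_zero)
  set g := assocMetric (pullMetric (E := E) x G) (fun _ ↦ 1) (rigForm x G N) with hgdef
  refine (mdifferentiableAt_totalSpace _ _).2 ⟨mdifferentiableAt_id, ?_⟩
  have hA := hg.contMDiffAt_coordForm p
  obtain ⟨L, hL⟩ := hg.isInvertible_coordForm (mem_chart_source E p)
  have hinv : ContDiffAt ℝ ∞ (ContinuousLinearMap.inverse (R := ℝ) (M := E) (M₂ := E →L[ℝ] ℝ)) (coordForm g p p) := by
    rw [← hL]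
    exact contDiffAt_map_inverse L
  have hB := ((hinv.contMDiffAt.comp p hA).clm_apply
    (contMDiffAt_coordRigForm hG hx.smooth hN p)).mdifferentiableAt (by simp)
  refine hB.congr_of_eventuallyEq ?_
  filter_upwards [eventually_mem_source hx.smooth p] with q hq
  obtain ⟨L, hL⟩ := hg.isInvertible_coordForm hq.1
  rw [Function.comp_apply, ← hL, ContinuousLinearMap.inverse_equiv]
  refine (L.symm_apply_eq.2 ?_).symm
  refine Eq.trans ?_ (DFunLike.congr_fun hL _).symm
  ext a
  rw [coordRigForm_eq hq.1 hq.2]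
  have h2 := coordForm_apply g hq.1 (rigged x G N q)
    ((trivializationAt E (TangentSpace 𝓘(ℝ, E) : M → Type _) p).symm q a)
  rw [trivializationAt_symm_apply hq.1] at h2
  refine Eq.trans ?_ h2.symm
  obtain ⟨hξ, hηξ⟩ := rigged_spec hdim hG hx hN hnull q
  rw [hgdef, assocMetric_apply, hξ, hηξ]
  ring

end Rigging

/-! ### Metric duality -/

section Sharp

variable {E : Type*} [NormedAddCommGroup E] [NormedSpace ℝ E]
  {M : Type*} [TopologicalSpace M] [ChartedSpace E M] [IsManifold 𝓘(ℝ, E) ∞ M]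

theorem IsSemiRiemannian.eq_of_forall_apply_eq {g : BilinField E M} (hg : IsSemiRiemannian g)
    {p : M} {u v : TangentSpace 𝓘(ℝ, E) p} (h : ∀ w, g p u w = g p v w) : u = v := by
  rw [← sub_eq_zero]
  refine hg.nondeg p _ fun w ↦ ?_
  rw [map_sub, sub_apply, h, sub_self]

variable [FiniteDimensional ℝ E]

theorem IsSemiRiemannian.sharp_spec {g : BilinField E M} (hg : IsSemiRiemannian g) (p : M)
    (θ : TangentSpace 𝓘(ℝ, E) p →L[ℝ] ℝ) (w : TangentSpace 𝓘(ℝ, E) p) :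
    g p (sharp g p θ) w = θ w := by
  refine Classical.epsilon_spec (p := fun v : TangentSpace 𝓘(ℝ, E) p ↦ ∀ w, g p v w = θ w) ?_ w
  obtain ⟨L, hL⟩ := hg.isInvertible_coordForm (mem_chart_source E p)
  refine ⟨L.symm θ, fun w ↦ ?_⟩
  have h1 : coordForm g p p (L.symm θ) = θ :=
    (DFunLike.congr_fun hL _).symm.trans (L.apply_symm_apply θ)
  have h2 : coordForm g p p (L.symm θ) w = θ w := DFunLike.congr_fun h1 w
  refine Eq.trans ?_ h2
  have h3 := coordForm_apply_symm (F := E) g (mem_chart_source E p) (L.symm θ) w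
  rw [trivializationAt_symm_self] at h3
  exact (h3.trans (congrArg (g p (L.symm θ)) (trivializationAt_symm_self (E := E) p w))).symm

end Sharp

/-! ### Derivatives of `g`, `η` and `gα` in terms of the ambient connection; the Koszul computation
-/

section Hypersurface

variable {E : Type*} [NormedAddCommGroup E] [NormedSpace ℝ E]
  {M : Type*} [TopologicalSpace M] [ChartedSpace E M]
  {F : Type*} [NormedAddCommGroup F] [NormedSpace ℝ F] [FiniteDimensional ℝ F]
  {W : Type*} [TopologicalSpace W] [ChartedSpace F W] [IsManifold 𝓘(ℝ, F) ∞ W]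
  {x : M → W} {G : BilinField F W} {O : Set W} {N : VField F W} {α : M → ℝ}
  {D : CovariantDerivative 𝓘(ℝ, F) F (TangentSpace 𝓘(ℝ, F) : W → Type _)}

/-- Replacing `[N, U]` by `∇̄_N U - ∇̄_U N`, the terms differentiated along `N` cancel against those
from metric compatibility. -/
theorem lieDeriv_rigging (hG : IsSemiRiemannian G) (hD : IsLeviCivita G D) {y : W}
    (hN : DiffAt N y) (u v : TangentSpace 𝓘(ℝ, F) y) :
    lieDeriv N G y u v = G y (D N y u) v + G y (D N y v) u := by
  have h1 := hD.torsion_free y N (ext u) hN (diffAt_ext u)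
  have h2 := hD.torsion_free y N (ext v) hN (diffAt_ext v)
  rw [ext_self] at h1 h2
  rw [lieDeriv, hD.metric y (ext u) (ext v) (N y) (diffAt_ext u) (diffAt_ext v), ← h1, ← h2,
    ext_self, ext_self, map_sub, map_sub, sub_apply, hG.symm y (D N y v)]
  ring

variable [IsManifold 𝓘(ℝ, E) ∞ M]

theorem mdifferentiableAt_pullMetric (hG : IsSemiRiemannian G)
    (hx : ContMDiff 𝓘(ℝ, E) 𝓘(ℝ, F) ∞ x) {Y Z : VField E M} {p : M}
    (hY : DiffAt Y p) (hZ : DiffAt Z p) :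
    MDifferentiableAt 𝓘(ℝ, E) 𝓘(ℝ, ℝ) (fun q ↦ pullMetric x G q (Y q) (Z q)) p :=
  mdifferentiableAt_apply_along (G := G) hG (hY.diffAlong_incl hx) (hZ.diffAlong_incl hx)

theorem mdifferentiableAt_rigForm (hG : IsSemiRiemannian G)
    (hx : ContMDiff 𝓘(ℝ, E) 𝓘(ℝ, F) ∞ x) (hN : IsNullRigging E F x G O N) {Y : VField E M} {p : M}
    (hY : DiffAt Y p) :
    MDifferentiableAt 𝓘(ℝ, E) 𝓘(ℝ, ℝ) (fun q ↦ rigForm x G N q (Y q)) p :=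
  mdifferentiableAt_apply_along hG
    ((hN.diffAt p).comp p ((hx p).mdifferentiableAt (by simp)) : DiffAlong E x (fun q ↦ N (x q)) p)
    (hY.diffAlong_incl hx)

theorem mvfderiv_pullMetric (hG : IsSemiRiemannian G) (hD : IsLeviCivita G D)
    (hx : ContMDiff 𝓘(ℝ, E) 𝓘(ℝ, F) ∞ x) {Y Z : VField E M} {p : M}
    (hY : DiffAt Y p) (hZ : DiffAt Z p) (v : TangentSpace 𝓘(ℝ, E) p) :
    mvfderiv 𝓘(ℝ, E) (fun q ↦ pullMetric x G q (Y q) (Z q)) p v =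
      G (x p) (derivAlong D x (fun q ↦ incl E F x q (Y q)) p v) (incl E F x p (Z p)) +
      G (x p) (incl E F x p (Y p)) (derivAlong D x (fun q ↦ incl E F x q (Z q)) p v) :=
  hD.mvfderiv_along hG (hY.diffAlong_incl hx) (hZ.diffAlong_incl hx) v

theorem mvfderiv_rigForm (hG : IsSemiRiemannian G) (hD : IsLeviCivita G D)
    (hx : ContMDiff 𝓘(ℝ, E) 𝓘(ℝ, F) ∞ x) (hN : IsNullRigging E F x G O N) {Y : VField E M} {p : M}
    (hY : DiffAt Y p) (v : TangentSpace 𝓘(ℝ, E) p) :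
    mvfderiv 𝓘(ℝ, E) (fun q ↦ rigForm x G N q (Y q)) p v =
      G (x p) (D N (x p) (incl E F x p v)) (incl E F x p (Y p)) +
      G (x p) (N (x p)) (derivAlong D x (fun q ↦ incl E F x q (Y q)) p v) := by
  have hx' := (hx p).mdifferentiableAt (by simp)
  rw [← hD.derivAlong_comp hG hx' (hN.diffAt p)]
  exact hD.mvfderiv_along hG
    ((hN.diffAt p).comp p hx' : DiffAlong E x (fun q ↦ N (x q)) p) (hY.diffAlong_incl hx) v

theorem mvfderiv_assocMetric (hG : IsSemiRiemannian G) (hD : IsLeviCivita G D)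
    (hx : ContMDiff 𝓘(ℝ, E) 𝓘(ℝ, F) ∞ x) (hN : IsNullRigging E F x G O N)
    (hα : ContMDiff 𝓘(ℝ, E) 𝓘(ℝ, ℝ) ∞ α) {Y Z : VField E M} {p : M}
    (hY : DiffAt Y p) (hZ : DiffAt Z p) (v : TangentSpace 𝓘(ℝ, E) p) :
    mvfderiv 𝓘(ℝ, E)
        (fun q ↦ assocMetric (pullMetric x G) α (rigForm x G N) q (Y q) (Z q)) p v =
      G (x p) (derivAlong D x (fun q ↦ incl E F x q (Y q)) p v) (incl E F x p (Z p)) +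
      G (x p) (incl E F x p (Y p)) (derivAlong D x (fun q ↦ incl E F x q (Z q)) p v) +
      (mvfderiv 𝓘(ℝ, E) α p v * (rigForm x G N p (Y p) * rigForm x G N p (Z p)) +
      α p * ((G (x p) (D N (x p) (incl E F x p v)) (incl E F x p (Y p)) +
          G (x p) (N (x p)) (derivAlong D x (fun q ↦ incl E F x q (Y q)) p v)) *
            rigForm x G N p (Z p) +
        rigForm x G N p (Y p) * (G (x p) (D N (x p) (incl E F x p v)) (incl E F x p (Z p)) +
          G (x p) (N (x p)) (derivAlong D x (fun q ↦ incl E F x q (Z q)) p v)))) := by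
  have hηY := mdifferentiableAt_rigForm hG hx hN hY
  have hηZ := mdifferentiableAt_rigForm hG hx hN hZ
  have hα' := (hα p).mdifferentiableAt (by simp : (∞ : WithTop ℕ∞) ≠ 0)
  have h : (fun q ↦ assocMetric (pullMetric x G) α (rigForm x G N) q (Y q) (Z q)) =
      fun q ↦ pullMetric x G q (Y q) (Z q) +
        α q * (rigForm x G N q (Y q) * rigForm x G N q (Z q)) := rfl
  have hηη : MDifferentiableAt 𝓘(ℝ, E) 𝓘(ℝ, ℝ)
      (fun q ↦ rigForm x G N q (Y q) * rigForm x G N q (Z q)) p := hηY.mul hηZ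
  have hαη : MDifferentiableAt 𝓘(ℝ, E) 𝓘(ℝ, ℝ)
      (fun q ↦ α q * (rigForm x G N q (Y q) * rigForm x G N q (Z q))) p := hα'.mul hηη
  rw [h, mvfderiv_fun_add (mdifferentiableAt_pullMetric hG hx hY hZ) hαη,
    mvfderiv_fun_mul hα' hηη, mvfderiv_fun_mul hηY hηZ]
  simp only [add_apply, smul_apply, smul_eq_mul]
  rw [mvfderiv_pullMetric hG hD hx hY hZ, mvfderiv_rigForm hG hD hx hN hY,
    mvfderiv_rigForm hG hD hx hN hZ]
  ring

theorem extDeriv₁_rigForm (hG : IsSemiRiemannian G) (hD : IsLeviCivita G D)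
    (hx : ContMDiff 𝓘(ℝ, E) 𝓘(ℝ, F) ∞ x) (hN : IsNullRigging E F x G O N) (p : M)
    (u v : TangentSpace 𝓘(ℝ, E) p) :
    extDeriv₁ (rigForm x G N) p u v =
      G (x p) (D N (x p) (incl E F x p u)) (incl E F x p v) -
      G (x p) (D N (x p) (incl E F x p v)) (incl E F x p u) := by
  rw [extDeriv₁, mvfderiv_rigForm hG hD hx hN (diffAt_ext v),
    mvfderiv_rigForm hG hD hx hN (diffAt_ext u), rigForm_apply,
    ← hD.derivAlong_symm hx (diffAt_ext u) (diffAt_ext v), map_sub, ext_self, ext_self]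
  ring

variable [FiniteDimensional ℝ E]

theorem leviCivita_assocMetric_eq (hdim : Module.finrank ℝ F = Module.finrank ℝ E + 1)
    (hG : IsSemiRiemannian G) (hD : IsLeviCivita G D) (hx : IsSubmanifold E F x)
    (hN : IsNullRigging E F x G O N) (hnull : IsNull (pullMetric (E := E) x G))
    (hα : ContMDiff 𝓘(ℝ, E) 𝓘(ℝ, ℝ) ∞ α) (hα0 : ∀ p, α p ≠ 0)
    {η : FormField E M} (hη : η = rigForm x G N)
    {gα : BilinField E M} (hgα : gα = assocMetric (pullMetric x G) α η)
    {Dα : CovariantDerivative 𝓘(ℝ, E) E (TangentSpace 𝓘(ℝ, E) : M → Type _)}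
    (hDα : IsLeviCivita gα Dα) {X Y : VField E M} {p : M} (hX : DiffAt X p) (hY : DiffAt Y p) :
    Dα Y p (X p) =
      nabla D x N X Y p
      - (1 / 2 * η p (X p) * η p (Y p)) • sharp gα p (mvfderiv 𝓘(ℝ, E) α p)
      + (α p / 2) •
          (η p (X p) • sharp gα p (extDeriv₁ η p (Y p))
            + η p (Y p) • sharp gα p (extDeriv₁ η p (X p)))
      + (1 / (2 * α p) *
          (α p * lieDeriv N G (x p) (incl _ _ x p (X p)) (incl _ _ x p (Y p))
            + 2 * sff D x N X Y p
            + mvfderiv 𝓘(ℝ, E) α p (X p) * η p (Y p)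
            + mvfderiv 𝓘(ℝ, E) α p (Y p) * η p (X p))) • rigged x G N p := by
  subst hη
  have hgα' : IsSemiRiemannian gα := by
    rw [hgα]
    exact isSemiRiemannian_assocMetric hdim hG hx hN hnull hα hα0
  refine hgα'.eq_of_forall_apply_eq fun w ↦ ?_
  have hdη : ∀ u : TangentSpace 𝓘(ℝ, E) p, gα p (sharp gα p (extDeriv₁ (rigForm x G N) p u)) w =
      G (x p) (D N (x p) (incl E F x p u)) (incl E F x p w) -
      G (x p) (D N (x p) (incl E F x p w)) (incl E F x p u) := fun u ↦ by
    -- `extDeriv₁` is defined through local extensions and is a priori only a function of `v`; it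
    -- must be shown to be a continuous linear form before its sharp can be evaluated.
    have h : extDeriv₁ (rigForm x G N) p u =
        ((G (x p) (D N (x p) (incl E F x p u))).comp (incl E F x p) -
          (G (x p) (incl E F x p u)).comp ((D N (x p)).comp (incl E F x p)) :
          TangentSpace 𝓘(ℝ, E) p →L[ℝ] ℝ) := by
      funext v
      rw [extDeriv₁_rigForm hG hD hx.smooth hN, hG.symm _ (D N (x p) (incl E F x p v))]
      rfl
    rw [h, hgα'.sharp_spec, hG.symm _ (D N (x p) (incl E F x p w))]
    rfl
  have hdα := hgα'.sharp_spec p (mvfderiv 𝓘(ℝ, E) α p) w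
  obtain ⟨hξ, hηξ⟩ := rigged_spec hdim hG hx hN hnull p
  have hξw : gα p (rigged x G N p) w = α p * rigForm x G N p w := by
    rw [hgα, assocMetric_apply, hξ, hηξ]
    ring
  have hsplit := hN.split_spec hdim hx p (ambientNabla D x X Y p)
  have hnab : incl E F x p (nabla D x N X Y p) =
      ambientNabla D x X Y p - sff D x N X Y p • N (x p) := eq_sub_of_add_eq hsplit.symm
  -- Removing `B(X, Y) N` from `∇̄_X Y` costs `B(X, Y) η(w)` in the `g`-part but nothing in the
  -- `η`-part, because `N` is null. This is the source of the `B` term along `ξ`.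
  have hnabw : gα p (nabla D x N X Y p) w =
      G (x p) (ambientNabla D x X Y p) (incl E F x p w) - sff D x N X Y p * rigForm x G N p w +
        α p * (G (x p) (N (x p)) (ambientNabla D x X Y p) * rigForm x G N p w) := by
    rw [hgα, assocMetric_apply, pullMetric_apply, rigForm_apply (u := nabla D x N X Y p), hnab,
      map_sub, map_sub, map_smul, map_smul, sub_apply, smul_apply, hN.lightlike, smul_zero,
      sub_zero, smul_eq_mul, ← rigForm_apply]
  simp only [map_add, map_sub, map_smul, add_apply, sub_apply, smul_apply, smul_eq_mul, hdη, hdα,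
    hξw, hnabw, lieDeriv_rigging hG hD (hN.diffAt p)]
  have tor : ∀ {U V : VField E M}, DiffAt U p → DiffAt V p → ∀ u,
      gα p (Dα V p (U p)) u - gα p (Dα U p (V p)) u =
        G (x p) (ambientNabla D x U V p) (incl E F x p u) -
          G (x p) (ambientNabla D x V U p) (incl E F x p u) +
        α p * ((G (x p) (N (x p)) (ambientNabla D x U V p) -
          G (x p) (N (x p)) (ambientNabla D x V U p)) * rigForm x G N p u) := by
    intro U V hU hV u
    rw [← sub_apply, ← map_sub, hDα.torsion_free p U V hU hV, hgα, assocMetric_apply,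
      pullMetric_apply, rigForm_apply (u := VectorField.mlieBracket _ _ _ _),
      ← hD.derivAlong_symm hx.smooth hU hV, map_sub, map_sub, sub_apply]
    rfl
  have met : ∀ {U V : VField E M} (v : TangentSpace 𝓘(ℝ, E) p), DiffAt U p → DiffAt V p →
      gα p (Dα U p v) (V p) + gα p (Dα V p v) (U p) =
      G (x p) (derivAlong D x (fun q ↦ incl E F x q (U q)) p v) (incl E F x p (V p)) +
      G (x p) (derivAlong D x (fun q ↦ incl E F x q (V q)) p v) (incl E F x p (U p)) +
      (mvfderiv 𝓘(ℝ, E) α p v * (rigForm x G N p (U p) * rigForm x G N p (V p)) +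
      α p * ((G (x p) (D N (x p) (incl E F x p v)) (incl E F x p (U p)) +
          G (x p) (N (x p)) (derivAlong D x (fun q ↦ incl E F x q (U q)) p v)) *
            rigForm x G N p (V p) +
        rigForm x G N p (U p) * (G (x p) (D N (x p) (incl E F x p v)) (incl E F x p (V p)) +
          G (x p) (N (x p)) (derivAlong D x (fun q ↦ incl E F x q (V q)) p v)))) := by
    intro U V v hU hV
    rw [hgα'.symm p (Dα V p v), ← hDα.metric p U V v hU hV, hgα,
      mvfderiv_assocMetric hG hD hx.smooth hN hα hU hV, hG.symm (x p) (incl E F x p (U p))]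
  -- The Koszul identity is evaluated at `p` only, so any differentiable extension of `w` serves as
  -- third field.
  have hZ := diffAt_ext w
  have m1 := met (X p) hY hZ
  have m2 := met (Y p) hX hZ
  have m3 := met w hX hY
  have t1 := tor hX hY w
  have t2 := tor hX hZ (Y p)
  have t3 := tor hY hZ (X p)
  unfold ambientNabla at t1 t2 t3 ⊢
  simp only [ext_self] at m1 m2 m3 t1 t2 t3
  have hαα : 1 / (2 * α p) * α p = 1 / 2 := by
    field_simp [hα0 p]
  -- Koszul's formula: metric identities along `X`, `Y`, `w` and torsion identities for the three
  -- pairs. The last summand only cancels `α` in the coefficient of `ξ`, using `gα(ξ, w) = α η(w)`.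
  linear_combination (1 / 2) * (m1 + m2 - m3 + t1 - t2 - t3) -
    ((α p * (G (x p) (D N (x p) (incl E F x p (X p))) (incl E F x p (Y p)) +
        G (x p) (D N (x p) (incl E F x p (Y p))) (incl E F x p (X p))) + 2 * sff D x N X Y p +
      mvfderiv 𝓘(ℝ, E) α p (X p) * rigForm x G N p (Y p) +
      mvfderiv 𝓘(ℝ, E) α p (Y p) * rigForm x G N p (X p)) * rigForm x G N p w) * hαα
-- Differentiating `η(PY) = 0` along `X` gives `G(∇̄_X N, PY) = -G(N, ∇̄_X PY)`, and the right side
-- is `-C(X, PY)` because `N` is null. The remaining part `η(Y) ξ` of `Y` contributes `τ(X) η(Y)`.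
-- No closedness is involved.
theorem apply_rigging_eq_neg_screenSff (hdim : Module.finrank ℝ F = Module.finrank ℝ E + 1)
    (hG : IsSemiRiemannian G) (hD : IsLeviCivita G D) (hx : IsSubmanifold E F x)
    (hN : IsNullRigging E F x G O N) (hnull : IsNull (pullMetric (E := E) x G))
    {X Y : VField E M} {p : M} (hY : DiffAt Y p) :
    G (x p) (D N (x p) (incl E F x p (X p))) (incl E F x p (Y p)) =
      -screenSff D x G N X Y p + rotation D x G N X p * rigForm x G N p (Y p) := by
  have hηY := mdifferentiableAt_rigForm hG hx.smooth hN hY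
  have hP : DiffAt (screenProj x G N Y) p :=
    mdifferentiableAt_sub_section hY
      (hηY.smul_section (diffAt_rigged hdim hG hx hN hnull p))
  have hηP : (fun q ↦ rigForm x G N q (screenProj x G N Y q)) = fun _ ↦ (0 : ℝ) := by
    funext q
    rw [screenProj, map_sub, map_smul, (rigged_spec hdim hG hx hN hnull q).2, smul_eq_mul, mul_one,
      sub_self]
  have h := mvfderiv_rigForm hG hD hx.smooth hN hP (X p)
  rw [hηP, mvfderiv_const] at h
  have hC : screenSff D x G N X Y p =
      G (x p) (N (x p)) (ambientNabla D x X (screenProj x G N Y) p) := by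
    have hs := hN.split_spec hdim hx p (ambientNabla D x X (screenProj x G N Y) p)
    conv_rhs => rw [hs]
    rw [map_add, map_smul, hN.lightlike, smul_zero, add_zero]
    rfl
  have hincl : incl E F x p (screenProj x G N Y p) = incl E F x p (Y p) -
      rigForm x G N p (Y p) • incl E F x p (rigged x G N p) := by
    rw [screenProj, map_sub, map_smul]
  rw [hincl, map_sub, map_smul, smul_eq_mul] at h
  rw [hC, rotation, ambientNabla]
  rw [zero_apply] at h
  linear_combination -h

end Hypersurface

end NullRigging

/-! ### The main theorem -/

open NullRigging in
theorem mainTheorem3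
    {E : Type*} [NormedAddCommGroup E] [NormedSpace ℝ E] [FiniteDimensional ℝ E]
    {F : Type*} [NormedAddCommGroup F] [NormedSpace ℝ F] [FiniteDimensional ℝ F]
    (hdim : Module.finrank ℝ F = Module.finrank ℝ E + 1)
    {M : Type*} [TopologicalSpace M] [ChartedSpace E M]
    [IsManifold 𝓘(ℝ, E) ∞ M]
    {W : Type*} [TopologicalSpace W] [ChartedSpace F W]
    [IsManifold 𝓘(ℝ, F) ∞ W]
    (G : BilinField F W) (hG : IsSemiRiemannian G)
    (D : CovariantDerivative 𝓘(ℝ, F) F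
      (TangentSpace 𝓘(ℝ, F) : W → Type _))
    (hD : IsLeviCivita G D)
    (x : M → W)
    (hx : IsSubmanifold E F x)
    (g : BilinField E M) (hg : g = pullMetric x G) (hnull : IsNull g)
    (O : Set W) (N : VField F W)
    (hN : IsNullRigging E F x G O N)
    (η : FormField E M) (hη : η = rigForm x G N)
    (ξ : VField E M) (hξ : ξ = rigged x G N)
    (α : M → ℝ) (hα : ContMDiff 𝓘(ℝ, E) 𝓘(ℝ, ℝ) ∞ α)
    (hα0 : ∀ p, α p ≠ 0)
    (gα : BilinField E M) (hgα : gα = assocMetric g α η) :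
    IsSemiRiemannian gα ∧
    ∀ Dα : CovariantDerivative 𝓘(ℝ, E) E
        (TangentSpace 𝓘(ℝ, E) : M → Type _),
      IsLeviCivita gα Dα →
      ∀ (X Y : VField E M) (p : M), DiffAt X p → DiffAt Y p →
        (Dα Y p (X p) =
          nabla D x N X Y p
          - (1 / 2 * η p (X p) * η p (Y p)) •
              sharp gα p (mvfderiv 𝓘(ℝ, E) α p)
          + (α p / 2) •
              (η p (X p) • sharp gα p (extDeriv₁ η p (Y p))
                + η p (Y p) • sharp gα p (extDeriv₁ η p (X p)))
          + (1 / (2 * α p) *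
              (α p * lieDeriv N G (x p) (incl _ _ x p (X p)) (incl _ _ x p (Y p))
                + 2 * sff D x N X Y p
                + mvfderiv 𝓘(ℝ, E) α p (X p) * η p (Y p)
                + mvfderiv 𝓘(ℝ, E) α p (Y p) * η p (X p))) • ξ p) ∧
        ((∀ q u v, extDeriv₁ η q u v = 0) →
          Dα Y p (X p) =
            nabla D x N X Y p
            - (1 / 2 * η p (X p) * η p (Y p)) •
                sharp gα p (mvfderiv 𝓘(ℝ, E) α p)
            + (1 / (2 * α p) *
                (2 * sff D x N X Y p
                  - 2 * α p * screenSff D x G N X Y p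
                  + 2 * α p * rotation D x G N X p * η p (Y p)
                  + mvfderiv 𝓘(ℝ, E) α p (X p) * η p (Y p)
                  + mvfderiv 𝓘(ℝ, E) α p (Y p) * η p (X p))) • ξ p) := by
  subst hg hξ
  refine ⟨by rw [hgα, hη]; exact isSemiRiemannian_assocMetric hdim hG hx hN hnull hα hα0, ?_⟩
  intro Dα hDα X Y p hX hY
  have key := leviCivita_assocMetric_eq hdim hG hD hx hN hnull hα hα0 hη hgα hDα hX hY
  refine ⟨key, fun hclosed ↦ ?_⟩
  have hgα' : IsSemiRiemannian gα := by
    rw [hgα, hη]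
    exact isSemiRiemannian_assocMetric hdim hG hx hN hnull hα hα0
  have hsharp : ∀ u, sharp gα p (extDeriv₁ η p u) = 0 := fun u ↦ by
    have h : extDeriv₁ η p u = (0 : TangentSpace 𝓘(ℝ, E) p →L[ℝ] ℝ) :=
      funext fun v ↦ hclosed p u v
    refine hgα'.nondeg p _ fun w ↦ ?_
    rw [h, hgα'.sharp_spec]
    rfl
  -- Closedness makes `G(∇̄_X N, Y)` symmetric in `X` and `Y`, so the two summands of the Lie
  -- derivative are equal.
  have hlie : lieDeriv N G (x p) (incl _ _ x p (X p)) (incl _ _ x p (Y p)) =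
      2 * (-screenSff D x G N X Y p + rotation D x G N X p * η p (Y p)) := by
    have hcl := hclosed p (X p) (Y p)
    rw [hη, extDeriv₁_rigForm hG hD hx.smooth hN] at hcl
    rw [lieDeriv_rigging hG hD (hN.diffAt p), hη,
      ← apply_rigging_eq_neg_screenSff hdim hG hD hx hN hnull hY]
    linear_combination -hcl
  rw [key, hsharp, hsharp, hlie]
  simp only [smul_zero, add_zero]
  congr 3
  ring
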